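/- Let $\mathcal S,\mathcal A$ be measurable spaces, $P(\cdot\mid s,a)$ a Markov transition kernel, $\gamma\in[0,1)$ a discount factor, and $\rho$ an initial distribution on $\mathcal S$. Let $\pi_\theta(\cdot\mid s)$, $\theta\in\mathbb R^d$, be a parameterized policy, given by probability densities $\pi_\theta(a\mid s)$, jointly measurable in $(s,a)$, with respect to a $\sigma$-finite reference measure on $\mathcal A$ (the counting measure for a countable action space). Let $$d_{\rho,\pi_\theta}(\cdot)=(1-\gamma)\,\mathbb E_{s^0\sim\rho}\Big[\sum_{h=0}^\infty\gamma^h\Pr(s^h\in\cdot\mid s^0,\pi_\theta)\Big],\qquad \tilde d_{\rho,\pi_\theta}(ds,da)=d_{\rho,\pi_\theta}(ds)\,\pi_\theta(da\mid s)$$ be the state and state-action visitation distributions, where $\Pr(s^h\in\cdot\mid s^0,\pi_\theta)$ is the law of the state at time $h$ of the process started at $s^0$ with $a^h\sim\pi_\theta(\cdot\mid s^h)$, $s^{h+1}\sim P(\cdot\mid s^h,a^h)$. Let $$F(\theta)=\mathbb E_{(s,a)\sim\tilde d_{\rho,\pi_\theta}}\big[\nabla\log\pi_\theta(a\mid s)\,\nabla\log\pi_\theta(a\mid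 s)^{\mathsf T}\big]$$ be the Fisher information matrix, with $\nabla$ the gradient in $\theta$. Fix $\theta,u\in\mathbb R^d$ and constants $M_g,\mu_F>0$. Assume that for all $s,a$ one has $\pi_\theta(a\mid s)>0$, $\log\pi_{\theta'}(a\mid s)$ is differentiable in $\theta'$ at $\theta'=\theta$, and $\|\nabla\log\pi_\theta(a\mid s)\|_2^2\le M_g$. Assume also that $F(\theta)\succeq\mu_F I_d$. Let $$\ell(w)=\tfrac12\,\mathbb E_{(s,a)\sim\tilde d_{\rho,\pi_\theta}}\big[(w^{\mathsf T}\nabla\log\pi_\theta(a\mid s))^2\big]-w^{\mathsf T}u .$$ Let $K\ge1$, let $(s_0,a_0),\dots,(s_{K-1},a_{K-1})$ be independent samples from $\tilde d_{\rho,\pi_\theta}$, and run SGD with step size $\eta=1/(4M_g)$ from $w^0=0$: $$w^{k+1}=w^k-\eta g_k,\qquad g_k=\big((w^k)^{\mathsf T}\nabla\log\pi_\theta(a_k\mid s_k)\big)\nabla\log\pi_\theta(a_k\mid s_k)-u,\qquad 0\le k\le K-1 .$$ Let $w_o=\frac1{K+1}\sum_{k=0}^K w^k$. Then: 1. $F(\theta)$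 is invertible and $\widehat w=F(\theta)^{-1}u$ is the unique minimizer of $\ell$. 2. The stochastic gradient is unbiased: for every $w\in\mathbb R^d$, the vector $(w^{\mathsf T}\nabla\log\pi_\theta(a\mid s))\nabla\log\pi_\theta(a\mid s)-u$ is integrable under $\tilde d_{\rho,\pi_\theta}$ and its mean is $\nabla\ell(w)$; and, for $0\le k<K$, $\mathbb E[g_k\mid (s_j,a_j)_{j<k}]=\nabla\ell(w^k)$ almost surely. 3. $\|w_o-\widehat w\|_2^2$ is integrable and $$\mathbb E\,\|w_o-\widehat w\|_2^2\;\le\;\frac{4M_g(\sqrt{2d}+1)^2}{K\mu_F^3}\,\|u\|_2^2 .$$ -/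

import Mathlib

open MeasureTheory ProbabilityTheory
open scoped ENNReal Matrix

noncomputable section

namespace NPG

/-- The dynamics of a discounted Markov decision process on measurable state and action spaces:
the transition kernel `P(· | s, a)` and the discount factor `γ ∈ [0, 1)`.  (The reward does not
enter the visitation distribution, the Fisher matrix or the regression subproblem.) -/
structure MDP (S A : Type*) [MeasurableSpace S] [MeasurableSpace A] where
  P : Kernel (S × A) S
  markov : IsMarkovKernel P
  γ : ℝ
  γ_nonneg : 0 ≤ γ
  γ_lt_one : γ < 1

/-- A policy `π_θ(a | s)` parameterized by `θ ∈ ℝ^d`, given by probability densities on the action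
space with respect to a reference measure `ν` (for instance the counting measure on a countable
action space, or Lebesgue measure on a Euclidean one). -/
structure ParamPolicy (d : ℕ) (S : Type*) {A : Type*} [MeasurableSpace S] [MeasurableSpace A]
    (ν : Measure A) where
  density : EuclideanSpace ℝ (Fin d) → S → A → ℝ
  measurable_density : ∀ θ, Measurable (Function.uncurry (density θ))
  density_nonneg : ∀ θ s a, 0 ≤ density θ s a
  lintegral_density : ∀ θ s, ∫⁻ a, ENNReal.ofReal (density θ s a) ∂ν = 1

variable {d : ℕ} {S A : Type*} [MeasurableSpace S] [MeasurableSpace A] {ν : Measure A}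

/-- The policy as a kernel `s ↦ π_θ(· | s)`. -/
def ParamPolicy.kernel [SigmaFinite ν] (π : ParamPolicy d S ν) (θ : EuclideanSpace ℝ (Fin d)) :
    Kernel S A :=
  Kernel.withDensity (Kernel.const S ν) (fun s a => ENNReal.ofReal (π.density θ s a))

/-- The one-step state transition under the policy: `a ∼ π_θ(· | s)`, `s' ∼ P(· | s, a)`. -/
def stateStep [SigmaFinite ν] (M : MDP S A) (π : ParamPolicy d S ν)
    (θ : EuclideanSpace ℝ (Fin d)) : Kernel S S :=
  M.P ∘ₖ (Kernel.id ×ₖ π.kernel θ)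

/-- `stateAt M π θ h s₀` is the law `Pr(s^h ∈ · | s^0 = s₀, π_θ)` of the state at time `h`. -/
def stateAt [SigmaFinite ν] (M : MDP S A) (π : ParamPolicy d S ν)
    (θ : EuclideanSpace ℝ (Fin d)) : ℕ → Kernel S S
  | 0 => Kernel.id
  | h + 1 => stateStep M π θ ∘ₖ stateAt M π θ h

/-- The state visitation distribution
`d_{ρ,π_θ} = (1 - γ) E_{s^0 ∼ ρ} [∑_h γ^h Pr(s^h ∈ · | s^0, π_θ)]`. -/
def stateVisitation [SigmaFinite ν] (M : MDP S A) (ρ : Measure S) (π : ParamPolicy d S ν)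
    (θ : EuclideanSpace ℝ (Fin d)) : Measure S :=
  ENNReal.ofReal (1 - M.γ) •
    ρ.bind (fun s₀ => Measure.sum (fun h : ℕ => ENNReal.ofReal (M.γ ^ h) • stateAt M π θ h s₀))

/-- The state-action visitation distribution `d̃_{ρ,π_θ}(ds, da) = d_{ρ,π_θ}(ds) π_θ(da | s)`. -/
def visitation [SigmaFinite ν] (M : MDP S A) (ρ : Measure S) (π : ParamPolicy d S ν)
    (θ : EuclideanSpace ℝ (Fin d)) : Measure (S × A) :=
  stateVisitation M ρ π θ ⊗ₘ π.kernel θ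

/-- The score `∇ log π_θ(a | s)`, the gradient being taken in `θ`. -/
def ParamPolicy.score (π : ParamPolicy d S ν) (θ : EuclideanSpace ℝ (Fin d)) (z : S × A) :
    EuclideanSpace ℝ (Fin d) :=
  gradient (fun θ' => Real.log (π.density θ' z.1 z.2)) θ

/-- At `θ` the log-density is well defined and differentiable, and its gradient satisfies
`‖∇ log π_θ(a | s)‖² ≤ M_g` for all `s` and `a`. -/
def ParamPolicy.ScoreBounded (π : ParamPolicy d S ν) (θ : EuclideanSpace ℝ (Fin d)) (Mg : ℝ) :
    Prop :=
  ∀ s a, 0 < π.density θ s a ∧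
    DifferentiableAt ℝ (fun θ' => Real.log (π.density θ' s a)) θ ∧
    ‖π.score θ (s, a)‖ ^ 2 ≤ Mg

/-- The Fisher information matrix
`F(θ) = E_{(s,a) ∼ d̃_{ρ,π_θ}} [∇ log π_θ(a | s) (∇ log π_θ(a | s))ᵀ]`. -/
def fisher [SigmaFinite ν] (M : MDP S A) (ρ : Measure S) (π : ParamPolicy d S ν)
    (θ : EuclideanSpace ℝ (Fin d)) : Matrix (Fin d) (Fin d) ℝ :=
  Matrix.of fun i j => ∫ z, π.score θ z i * π.score θ z j ∂(visitation M ρ π θ)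

/-- Fisher non-degeneracy at `θ` with constant `μF`: `F(θ) ≽ μF I`. -/
def FisherNondegenerate [SigmaFinite ν] (M : MDP S A) (ρ : Measure S) (π : ParamPolicy d S ν)
    (θ : EuclideanSpace ℝ (Fin d)) (μF : ℝ) : Prop :=
  (fisher M ρ π θ - μF • (1 : Matrix (Fin d) (Fin d) ℝ)).PosSemidef

/-- The regression loss
`ℓ(w) = ½ E_{(s,a) ∼ d̃_{ρ,π_θ}} [(wᵀ ∇ log π_θ(a | s))²] - wᵀ u`. -/
def loss [SigmaFinite ν] (M : MDP S A) (ρ : Measure S) (π : ParamPolicy d S ν)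
    (θ u w : EuclideanSpace ℝ (Fin d)) : ℝ :=
  1 / 2 * (∫ z, (inner ℝ w (π.score θ z)) ^ 2 ∂(visitation M ρ π θ)) - inner ℝ w u

/-- The direction `ŵ(u, θ) = F(θ)⁻¹ u`. -/
def exactDirection [SigmaFinite ν] (M : MDP S A) (ρ : Measure S) (π : ParamPolicy d S ν)
    (u θ : EuclideanSpace ℝ (Fin d)) : EuclideanSpace ℝ (Fin d) :=
  WithLp.toLp 2 ((fisher M ρ π θ)⁻¹ *ᵥ u.ofLp)

/-- The stochastic gradient `(wᵀ ∇ log π_θ(a | s)) ∇ log π_θ(a | s) - u` at a sample `z = (s, a)`. -/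
def stochGrad (π : ParamPolicy d S ν) (θ u w : EuclideanSpace ℝ (Fin d)) (z : S × A) :
    EuclideanSpace ℝ (Fin d) :=
  inner ℝ w (π.score θ z) • π.score θ z - u

/-- The SGD iterates `w^{k+1} = w^k - η g_k`, started at `w^0 = 0` and driven by the samples
`z 0, z 1, …`. -/
def sgdIterate (π : ParamPolicy d S ν) (θ u : EuclideanSpace ℝ (Fin d)) (η : ℝ) (z : ℕ → S × A) :
    ℕ → EuclideanSpace ℝ (Fin d)
  | 0 => 0
  | k + 1 => sgdIterate π θ u η z k - η • stochGrad π θ u (sgdIterate π θ u η z k) (z k)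

/-- The averaged output `(K + 1)⁻¹ ∑_{k=0}^{K} w^k`. -/
def sgdOutput (π : ParamPolicy d S ν) (θ u : EuclideanSpace ℝ (Fin d)) (η : ℝ) (z : ℕ → S × A)
    (K : ℕ) : EuclideanSpace ℝ (Fin d) :=
  ((K : ℝ) + 1)⁻¹ • ∑ k ∈ Finset.range (K + 1), sgdIterate π θ u η z k

end NPG

end

/-!
Averaged stochastic gradient descent for the compatible regression problem of the natural policy
gradient. Write `x` for the score of a random sample, `H = E[x xᵀ]` for the Fisher matrix, `ŵ` for
`H⁻¹ u`, `η = 1 / (4 M)` and `μ` for the non-degeneracy constant. The loss is the quadratic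
`½ ⟪w, H w⟫ - ⟪w, u⟫`, which gives the invertibility, the minimizer and the gradient. Differentiating
under the integral is not needed; the score is measurable as a limit of difference quotients.

For the error bound, the iterates satisfy `w_{k+1} = w_k - η (⟪w_k, x_k⟫ x_k - u)` with `x_k`
independent of `w_k`. Their mean is `y_k = ŵ - (1 - η H) ^ k ŵ`, and `0 ≤ 1 - η H ≤ 1` gives
`‖y_k‖ ≤ ‖ŵ‖` (`norm_sub_pow_apply_le`). The centred iterates `n_k = w_k - y_k` have mean zero
(`IsRun.integral_inner_centred`), and their covariance stays below `‖ŵ‖² / 7` times the identity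
(`IsRun.integral_inner_centred_sq_le`): one step applies the random contraction `1 - η x xᵀ`, which
loses `(2 η - η² M) H` on the average, and adds a noise of covariance at most `η² M ‖ŵ‖² H`.

The average has a bias and a variance. The bias is a geometric sum in `1 - η H`, bounded both by
`‖ŵ‖` and by `4 M ‖ŵ‖ / (K μ)`, hence in square by the product of the two
(`IsRun.norm_sum_meanIterate_sub_le`). For the variance, summing the recursion against `p = H⁻¹ v`
expresses `⟪v, ∑ n_k⟫` by the last iterate and by a sum of martingale differences, whose second
moments are at most `(8 / 7) M ‖ŵ‖² ⟪p, H p⟫` each (`IsRun.integral_inner_average_centred_sq_le`).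
Adding the variances over an orthonormal basis yields the mean squared error bound
`4 M (2 d + 1) ‖ŵ‖² / (K μ)`, and `2 d + 1 ≤ (√(2 d) + 1)²` while `μ ‖ŵ‖ ≤ ‖u‖`.
-/

namespace AveragedSGD

/-! ### Powers of a symmetric operator between zero and one -/

section FirmlyNonexpansive

variable {E : Type*} [NormedAddCommGroup E] [InnerProductSpace ℝ E] {A : E →L[ℝ] E}

theorem norm_apply_le (hA : ∀ v, ‖A v‖ ^ 2 ≤ inner ℝ v (A v)) (v : E) : ‖A v‖ ≤ ‖v‖ := by
  have h1 := hA v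
  have h2 := real_inner_le_norm v (A v)
  rcases (norm_nonneg (A v)).eq_or_lt with h0 | h0
  · rw [← h0]; positivity
  · nlinarith

theorem norm_pow_apply_le (hA : ∀ v, ‖A v‖ ^ 2 ≤ inner ℝ v (A v)) (k : ℕ) (v : E) :
    ‖(A ^ k) v‖ ≤ ‖v‖ := by
  induction k with
  | zero => simp
  | succ k ih =>
    rw [pow_succ', mul_apply_eq_comp]
    exact (norm_apply_le hA _).trans ih

theorem inner_pow_apply_left (hsymm : ∀ v w, inner ℝ (A v) w = inner ℝ v (A w)) (k : ℕ)
    (v w : E) : inner ℝ ((A ^ k) v) w = inner ℝ v ((A ^ k) w) := by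
  induction k generalizing w with
  | zero => simp
  | succ k ih =>
    rw [pow_succ', mul_apply_eq_comp, hsymm, ih, ← mul_apply_eq_comp,
      ← pow_succ, pow_succ']

theorem antitone_inner_pow_apply (hsymm : ∀ v w, inner ℝ (A v) w = inner ℝ v (A w))
    (hA : ∀ v, ‖A v‖ ^ 2 ≤ inner ℝ v (A v)) (v : E) :
    Antitone fun k : ℕ => inner ℝ v ((A ^ k) v) := by
  refine antitone_nat_of_succ_le fun k => ?_
  have split : ∀ i j : ℕ, inner ℝ v ((A ^ (i + j)) v) = inner ℝ ((A ^ i) v) ((A ^ j) v) := by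
    intro i j
    rw [pow_add, mul_apply_eq_comp, inner_pow_apply_left hsymm]
  rcases Nat.even_or_odd' k with ⟨j, rfl | rfl⟩
  · rw [two_mul, add_assoc, split, split, real_inner_self_eq_norm_sq, pow_succ',
      mul_apply_eq_comp]
    have h1 := real_inner_le_norm ((A ^ j) v) (A ((A ^ j) v))
    have h2 := norm_apply_le hA ((A ^ j) v)
    nlinarith [norm_nonneg ((A ^ j) v)]
  · rw [show 2 * j + 1 + 1 = (j + 1) + (j + 1) by ring, show 2 * j + 1 = j + (j + 1) by ring,
      split, split, real_inner_self_eq_norm_sq, pow_succ' A, mul_apply_eq_comp]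
    exact hA _

/-- For a symmetric operator `0 ≤ A ≤ 1`, also `0 ≤ 1 - A ^ k ≤ 1`; the hypothesis `hA` is a way
of saying `0 ≤ A ≤ 1` that needs no square root. -/
theorem norm_sub_pow_apply_le (hsymm : ∀ v w, inner ℝ (A v) w = inner ℝ v (A w))
    (hA : ∀ v, ‖A v‖ ^ 2 ≤ inner ℝ v (A v)) (k : ℕ) (v : E) : ‖v - (A ^ k) v‖ ≤ ‖v‖ := by
  have h1 := antitone_inner_pow_apply hsymm hA v (show k ≤ k + k by lia)
  simp only [pow_add, mul_apply_eq_comp] at h1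
  rw [← inner_pow_apply_left hsymm, real_inner_self_eq_norm_sq] at h1
  have h2 := norm_sub_sq_real v ((A ^ k) v)
  refine le_of_sq_le_sq ?_ (norm_nonneg _) 
  nlinarith [sq_nonneg ‖(A ^ k) v‖]

end FirmlyNonexpansive

/-! ### Bounded measurable functions -/

section BoundedMeasurable

/-- Measurable with bounded range: a class of functions closed under the algebraic operations and
integrable against every finite measure. -/
def BoundedMeasurable {α G : Type*} [MeasurableSpace α] [MeasurableSpace G] [Norm G]
    (f : α → G) : Prop :=
  Measurable f ∧ ∃ C : ℝ, ∀ a, ‖f a‖ ≤ C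

variable {α β G : Type*} [MeasurableSpace α] [MeasurableSpace β] [NormedAddCommGroup G]
  [MeasurableSpace G]

namespace BoundedMeasurable

theorem const (c : G) : BoundedMeasurable fun _ : α => c :=
  ⟨measurable_const, ‖c‖, fun _ => le_rfl⟩

theorem comp {f : α → G} (hf : BoundedMeasurable f) {g : β → α} (hg : Measurable g) :
    BoundedMeasurable fun b => f (g b) :=
  ⟨hf.1.comp hg, hf.2.imp fun _ h b => h (g b)⟩

variable [InnerProductSpace ℝ G] [FiniteDimensional ℝ G] [BorelSpace G]

theorem add {f g : α → G} (hf : BoundedMeasurable f) (hg : BoundedMeasurable g) :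
    BoundedMeasurable fun a => f a + g a := by
  obtain ⟨hf, C, hC⟩ := hf
  obtain ⟨hg, C', hC'⟩ := hg
  have := FiniteDimensional.proper ℝ G
  exact ⟨hf.add hg, C + C', fun a => norm_add_le_of_le (hC a) (hC' a)⟩

theorem sub {f g : α → G} (hf : BoundedMeasurable f) (hg : BoundedMeasurable g) :
    BoundedMeasurable fun a => f a - g a := by
  obtain ⟨hf, C, hC⟩ := hf
  obtain ⟨hg, C', hC'⟩ := hg
  have := FiniteDimensional.proper ℝ G
  exact ⟨hf.sub hg, C + C', fun a => norm_sub_le_of_le (hC a) (hC' a)⟩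

theorem smul {c : α → ℝ} {f : α → G} (hc : BoundedMeasurable c) (hf : BoundedMeasurable f) :
    BoundedMeasurable fun a => c a • f a := by
  obtain ⟨hf, C, hC⟩ := hf
  obtain ⟨hc, C', hC'⟩ := hc
  refine ⟨hc.smul hf, C' * C, fun a => ?_⟩
  rw [norm_smul]
  exact mul_le_mul (hC' a) (hC a) (norm_nonneg _) ((norm_nonneg _).trans (hC' a))

theorem mul {c f : α → ℝ} (hc : BoundedMeasurable c) (hf : BoundedMeasurable f) :
    BoundedMeasurable fun a => c a * f a :=
  hc.smul hf

theorem sq {f : α → ℝ} (hf : BoundedMeasurable f) : BoundedMeasurable fun a => f a ^ 2 := by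
  simpa only [pow_two] using hf.mul hf

theorem inner {f g : α → G} (hf : BoundedMeasurable f) (hg : BoundedMeasurable g) :
    BoundedMeasurable fun a => inner ℝ (f a) (g a) := by
  obtain ⟨hf, C, hC⟩ := hf
  obtain ⟨hg, C', hC'⟩ := hg
  have := FiniteDimensional.proper ℝ G
  refine ⟨hf.inner hg, C * C', fun a => (norm_inner_le_norm _ _).trans ?_⟩
  exact mul_le_mul (hC a) (hC' a) (norm_nonneg _) ((norm_nonneg _).trans (hC a))

theorem norm_sq {f : α → G} (hf : BoundedMeasurable f) :
    BoundedMeasurable fun a => ‖f a‖ ^ 2 := by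
  simpa only [real_inner_self_eq_norm_sq] using hf.inner hf

theorem sum {ι : Type*} (s : Finset ι) {f : ι → α → G} (hf : ∀ i ∈ s, BoundedMeasurable (f i)) :
    BoundedMeasurable fun a => ∑ i ∈ s, f i a := by
  classical
  induction s using Finset.induction_on with
  | empty => simpa using const (0 : G)
  | insert i s hi ih =>
    simp only [Finset.sum_insert hi]
    exact (hf i (by simp)).add (ih fun j hj => hf j (by simp [hj]))

theorem integrable {f : α → G} (hf : BoundedMeasurable f) (m : Measure α) [IsFiniteMeasure m] :
    Integrable f m := by
  obtain ⟨hf, C, hC⟩ := hf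
  have := FiniteDimensional.proper ℝ G
  exact Integrable.of_bound hf.aestronglyMeasurable C (.of_forall hC)

/-- The variance is at most the second moment. -/
theorem integral_sub_integral_sq_le {f : α → ℝ} (hf : BoundedMeasurable f) (m : Measure α)
    [IsProbabilityMeasure m] : ∫ a, (f a - ∫ b, f b ∂m) ^ 2 ∂m ≤ ∫ a, f a ^ 2 ∂m := by
  set c := ∫ b, f b ∂m with hc
  calc _ = ∫ a, (f a ^ 2 - (2 * c) * f a + c ^ 2) ∂m := by congr 1; ext a; ring
    _ = ∫ a, f a ^ 2 ∂m - c ^ 2 := by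
      rw [integral_add, integral_sub, integral_const_mul, integral_const, ← hc]
      · simp; ring
      · exact hf.sq.integrable m
      · exact ((const _).mul hf).integrable m
      · exact (hf.sq.sub ((const _).mul hf)).integrable m
      · exact integrable_const _
    _ ≤ _ := by linarith [sq_nonneg c]

end BoundedMeasurable

end BoundedMeasurable

/-! ### Freezing an independent variable -/

/-- Freezing lemma: in the mean of a function of two independent variables `U` and `Y`, the second
may be replaced by an independent copy living on a space of its own. -/
theorem integral_comp_eq_integral_prod {Ω β Z G : Type*} [MeasurableSpace Ω] [MeasurableSpace β]
    [MeasurableSpace Z] [NormedAddCommGroup G] [NormedSpace ℝ G] {Pr : Measure Ω}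
    [IsProbabilityMeasure Pr] {U : Ω → β} {Y : Ω → Z} (hU : Measurable U) (hY : Measurable Y)
    (hUY : IndepFun U Y Pr) {f : β × Z → G} (hf : StronglyMeasurable f) :
    ∫ ω, f (U ω, Y ω) ∂Pr = ∫ q, f (U q.1, q.2) ∂(Pr.prod (Pr.map Y)) := by
  have := Measure.isProbabilityMeasure_map (μ := Pr) hY.aemeasurable
  have h1 := (indepFun_iff_map_prod_eq_prod_map_map hU.aemeasurable hY.aemeasurable).1 hUY
  have h2 : (Pr.map U).prod (Pr.map Y) = (Pr.prod (Pr.map Y)).map (Prod.map U id) := by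
    rw [← Measure.map_prod_map _ _ hU measurable_id, Measure.map_id]
  rw [← integral_map (φ := fun ω => (U ω, Y ω)) (f := f) (by fun_prop) hf.aestronglyMeasurable,
    h1, h2, integral_map (by fun_prop) hf.aestronglyMeasurable]
  rfl

/-! ### The second moment operator -/

section SecondMoment

variable {Z E : Type*} [MeasurableSpace Z] [NormedAddCommGroup E] [InnerProductSpace ℝ E]

theorem sq_inner_le {M : ℝ} {x v : E} (hx : ‖x‖ ^ 2 ≤ M) :
    inner ℝ v x ^ 2 ≤ M * ‖v‖ ^ 2 := by
  have := abs_le.1 (abs_real_inner_le_norm v x)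
  nlinarith [sq_nonneg ‖v‖, norm_nonneg v, norm_nonneg x]

/-- The second moment operator `v ↦ E[⟪v, x⟫ x]` of the random vector `x`. -/
noncomputable def secondMoment (D : Measure Z) (x : Z → E) : E →L[ℝ] E :=
  ∫ z, (innerSL ℝ (x z)).smulRight (x z) ∂D

/-- The operator `1 - η H` by which one gradient step moves the mean error, for the step size
`η = 1 / (4 M)` and the second moment operator `H`. -/
noncomputable def contraction (D : Measure Z) (x : Z → E) (M : ℝ) : E →L[ℝ] E :=
  1 - (1 / (4 * M)) • secondMoment D x

theorem contraction_apply {D : Measure Z} {x : Z → E} {M : ℝ} (v : E) :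
    contraction D x M v = v - (1 / (4 * M)) • secondMoment D x v := rfl

variable [FiniteDimensional ℝ E] [MeasurableSpace E] [BorelSpace E] {D : Measure Z}
  [IsProbabilityMeasure D] {x : Z → E} {M : ℝ}

theorem secondMoment_apply (hx : BoundedMeasurable x) (v : E) :
    secondMoment D x v = ∫ z, inner ℝ v (x z) • x z ∂D := by
  have := FiniteDimensional.proper ℝ E
  obtain ⟨hx, C, hC⟩ := hx
  rw [secondMoment, ContinuousLinearMap.integral_apply]
  · simp [real_inner_comm]
  · have hcont : Continuous fun y : E => (innerSL ℝ y).smulRight y := by fun_prop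
    refine Integrable.of_bound (C := C * C)
      (hcont.comp_aestronglyMeasurable hx.aestronglyMeasurable) (.of_forall fun z => ?_)
    rw [ContinuousLinearMap.norm_smulRight_apply, innerSL_apply_norm]
    have := hC z
    have := norm_nonneg (x z)
    gcongr
    linarith

theorem inner_secondMoment (hx : BoundedMeasurable x) (v w : E) :
    inner ℝ (secondMoment D x v) w = ∫ z, inner ℝ v (x z) * inner ℝ w (x z) ∂D := by
  have := FiniteDimensional.proper ℝ E
  rw [secondMoment_apply hx, real_inner_comm,
    ← integral_inner ((((BoundedMeasurable.const v).inner hx).smul hx).integrable D)]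
  simp only [inner_smul_right]

theorem inner_secondMoment_self (hx : BoundedMeasurable x) (v : E) :
    inner ℝ v (secondMoment D x v) = ∫ z, inner ℝ v (x z) ^ 2 ∂D := by
  rw [real_inner_comm, inner_secondMoment hx]
  simp only [pow_two]

theorem inner_secondMoment_comm (hx : BoundedMeasurable x) (v w : E) :
    inner ℝ (secondMoment D x v) w = inner ℝ v (secondMoment D x w) := by
  rw [inner_secondMoment hx, real_inner_comm, inner_secondMoment hx]
  simp only [mul_comm]

/-- `H² ≤ M H` for a second moment operator `H` of vectors bounded by `‖x‖² ≤ M`. -/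
theorem norm_secondMoment_sq_le (hx : BoundedMeasurable x) (hM : 0 < M)
    (hxM : ∀ z, ‖x z‖ ^ 2 ≤ M) (v : E) :
    ‖secondMoment D x v‖ ^ 2 ≤ M * inner ℝ v (secondMoment D x v) := by
  set h := secondMoment D x v with hh
  have key : inner ℝ h h ≤ M / 2 * ∫ z, inner ℝ v (x z) ^ 2 ∂D + 1 / 2 * ‖h‖ ^ 2 := by
    calc inner ℝ h h = ∫ z, inner ℝ v (x z) * inner ℝ h (x z) ∂D := inner_secondMoment hx v h
      _ ≤ ∫ z, (M / 2 * inner ℝ v (x z) ^ 2 + 1 / 2 * ‖h‖ ^ 2) ∂D := by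
        have b1 := (BoundedMeasurable.const (α := Z) v).inner hx
        have b2 := (BoundedMeasurable.const (α := Z) h).inner hx
        refine integral_mono ((b1.mul b2).integrable D)
          (((BoundedMeasurable.const (M / 2)).mul b1.sq).add
            (BoundedMeasurable.const _) |>.integrable D) fun z => ?_
        have h1 := sq_inner_le (v := h) (hxM z)
        have h2 := sq_nonneg (M * inner ℝ v (x z) - inner ℝ h (x z))
        refine le_of_mul_le_mul_left ?_ hM
        dsimp only
        nlinarith
      _ = _ := by
        rw [integral_add, integral_const_mul, integral_const]
        · simp
        · exact ((BoundedMeasurable.const (M / 2)).mul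
            ((BoundedMeasurable.const (α := Z) v).inner hx).sq).integrable D
        · exact integrable_const _
  rw [real_inner_self_eq_norm_sq] at key
  rw [inner_secondMoment_self hx]
  linarith

theorem inner_contraction_comm (hx : BoundedMeasurable x) (v w : E) :
    inner ℝ (contraction D x M v) w = inner ℝ v (contraction D x M w) := by
  simp only [contraction_apply, inner_sub_left, inner_sub_right, inner_smul_left,
    inner_smul_right, inner_secondMoment_comm hx]
  rfl

/-- `A² ≤ A` for `A = 1 - η H`, which is `0 ≤ A ≤ 1`; it holds because `η H ≤ 1 / 4`. -/
theorem norm_contraction_sq_le (hx : BoundedMeasurable x) (hM : 0 < M)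
    (hxM : ∀ z, ‖x z‖ ^ 2 ≤ M) (v : E) :
    ‖contraction D x M v‖ ^ 2 ≤ inner ℝ v (contraction D x M v) := by
  have h1 := norm_secondMoment_sq_le (D := D) hx hM hxM v
  have h2 : 0 ≤ inner ℝ v (secondMoment D x v) := by
    rw [inner_secondMoment_self hx]
    exact integral_nonneg fun z => sq_nonneg _
  rw [contraction_apply, norm_sub_sq_real, inner_sub_right, inner_smul_right, norm_smul, mul_pow,
    real_inner_self_eq_norm_sq, Real.norm_eq_abs, sq_abs]
  have h3 : (1 / (4 * M)) ^ 2 * ‖secondMoment D x v‖ ^ 2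
      ≤ 1 / 4 * (1 / (4 * M) * inner ℝ v (secondMoment D x v)) := by
    calc _ ≤ (1 / (4 * M)) ^ 2 * (M * inner ℝ v (secondMoment D x v)) := by gcongr
      _ = _ := by field_simp
  have h4 : 0 ≤ 1 / (4 * M) * inner ℝ v (secondMoment D x v) := by positivity
  linarith

end SecondMoment

/-! ### Least-mean-squares iterates: mean and covariance -/

section Run

variable {Ω Z E : Type*} [MeasurableSpace Z] [NormedAddCommGroup E]
  [InnerProductSpace ℝ E]

/-- The information carried by the samples `X 0, …, X (k - 1)`. -/
abbrev past (X : ℕ → Ω → Z) (k : ℕ) : MeasurableSpace Ω :=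
  ⨆ j : Fin k, MeasurableSpace.comap (X j) inferInstance

theorem measurable_past (X : ℕ → Ω → Z) {j k : ℕ} (h : j < k) : Measurable[past X k] (X j) :=
  (comap_measurable (X j)).mono (le_iSup (fun i : Fin k => MeasurableSpace.comap (X i) _) ⟨j, h⟩)
    le_rfl

theorem past_mono (X : ℕ → Ω → Z) : Monotone (past X) := fun _ _ h =>
  iSup_le fun i => (measurable_past X (i.2.trans_le h)).comap_le

variable [mΩ : MeasurableSpace Ω]

theorem indep_past_of_iIndepFun {Pr : Measure Ω} {X : ℕ → Ω → Z} {K : ℕ}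
    (hX : ∀ k < K, Measurable (X k)) (hind : iIndepFun (fun k : Fin K => X k) Pr) {k : ℕ}
    (hk : k < K) : Indep (past X k) (MeasurableSpace.comap (X k) inferInstance) Pr := by
  have h := indep_iSup_of_disjoint (fun i : Fin K => (hX i i.2).comap_le) hind.iIndep
    (S := {i | (i : ℕ) < k}) (T := {⟨k, hk⟩}) (by simp)
  refine indep_of_indep_of_le_left (indep_of_indep_of_le_right h ?_) ?_
  · exact le_iSup₂_of_le (⟨k, hk⟩ : Fin K) rfl le_rfl
  · exact iSup_le fun j => le_iSup₂_of_le (⟨j, j.2.trans hk⟩ : Fin K) j.2 le_rfl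

/-- `w` is the trajectory, started at `0`, of least-mean-squares gradient descent with step size
`1 / (4 M)` on independent samples `X 0, …, X (K - 1)` of the law `D`, where `x` is the feature map,
bounded by `‖x‖² ≤ M`, and the quadratic objective is minimal at `wStar`. -/
structure IsRun (Pr : Measure Ω) (D : Measure Z) (x : Z → E) (M : ℝ) (wStar : E) (K : ℕ)
    (X : ℕ → Ω → Z) (w : ℕ → Ω → E) [MeasurableSpace E] : Prop where
  measurable_feature : Measurable x
  bound_pos : 0 < M
  norm_feature_sq_le : ∀ z, ‖x z‖ ^ 2 ≤ M
  measurable_sample : ∀ k < K, Measurable (X k)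
  map_sample : ∀ k < K, Pr.map (X k) = D
  indep : ∀ k < K, Indep (past X k) (MeasurableSpace.comap (X k) inferInstance) Pr
  init : ∀ ω, w 0 ω = 0
  step : ∀ k ω, w (k + 1) ω = w k ω - (1 / (4 * M)) •
    (inner ℝ (w k ω) (x (X k ω)) • x (X k ω) - secondMoment D x wStar)

/-- The mean of the `k`-th iterate, `(1 - (1 - η H) ^ k) wStar`. -/
noncomputable def meanIterate (D : Measure Z) (x : Z → E) (M : ℝ) (wStar : E) (k : ℕ) : E :=
  wStar - (contraction D x M ^ k) wStar

theorem meanIterate_zero (D : Measure Z) (x : Z → E) (M : ℝ) (wStar : E) :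
    meanIterate D x M wStar 0 = 0 := by simp [meanIterate]

theorem meanIterate_succ (D : Measure Z) (x : Z → E) (M : ℝ) (wStar : E) (k : ℕ) :
    meanIterate D x M wStar (k + 1) = meanIterate D x M wStar k - (1 / (4 * M)) •
      (secondMoment D x (meanIterate D x M wStar k) - secondMoment D x wStar) := by
  rw [meanIterate, meanIterate, pow_succ', mul_apply_eq_comp, contraction_apply, map_sub]
  module

variable [MeasurableSpace E] {Pr : Measure Ω} {D : Measure Z} {x : Z → E} {M : ℝ} {wStar : E}
  {K : ℕ} {X : ℕ → Ω → Z} {w : ℕ → Ω → E}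

namespace IsRun

theorem boundedMeasurable_feature (h : IsRun Pr D x M wStar K X w) : BoundedMeasurable x :=
  ⟨h.measurable_feature, √M, fun z => Real.le_sqrt_of_sq_le (h.norm_feature_sq_le z)⟩

theorem past_le (h : IsRun Pr D x M wStar K X w) {k : ℕ} (hk : k ≤ K) : past X k ≤ mΩ :=
  iSup_le fun j => (h.measurable_sample j (j.2.trans_le hk)).comap_le

/-- The centred iterates solve the recursion with the random contraction `1 - η x xᵀ`, driven by a
noise that depends on the current sample alone. -/
theorem inner_centred_succ (h : IsRun Pr D x M wStar K X w) (k : ℕ) (v : E) (ω : Ω) :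
    inner ℝ v (w (k + 1) ω - meanIterate D x M wStar (k + 1)) =
      inner ℝ (v - (1 / (4 * M) * inner ℝ v (x (X k ω))) • x (X k ω))
        (w k ω - meanIterate D x M wStar k)
      - 1 / (4 * M) * (inner ℝ (meanIterate D x M wStar k) (x (X k ω)) * inner ℝ v (x (X k ω))
        - inner ℝ v (secondMoment D x (meanIterate D x M wStar k))) := by
  rw [h.step, meanIterate_succ]
  simp only [inner_sub_right, real_inner_smul_right, real_inner_comm _ (w k ω),
    real_inner_comm _ (meanIterate D x M wStar k), inner_sub_left, real_inner_smul_left]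
  ring

/-- A function of the past and the current sample has the same mean when the sample is replaced by
an independent copy. -/
theorem integral_eq_integral_prod [IsProbabilityMeasure Pr]
    (h : IsRun Pr D x M wStar K X w) {k : ℕ} (hk : k < K)
    {β G : Type*} [MeasurableSpace β] [NormedAddCommGroup G] [NormedSpace ℝ G] {U : Ω → β}
    (hU : Measurable[past X k] U) {f : β × Z → G} (hf : StronglyMeasurable f) :
    ∫ ω, f (U ω, X k ω) ∂Pr = ∫ q, f (U q.1, q.2) ∂(Pr.prod D) := by
  rw [← h.map_sample k hk]
  refine integral_comp_eq_integral_prod (hU.mono (h.past_le hk.le) le_rfl)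
    (h.measurable_sample k hk) ?_ hf
  exact indep_of_indep_of_le_left (h.indep k hk) hU.comap_le

variable [FiniteDimensional ℝ E] [BorelSpace E]

theorem measurable_past_iterate (h : IsRun Pr D x M wStar K X w) (k : ℕ) :
    Measurable[past X k] (w k) := by
  induction k with
  | zero =>
    have : w 0 = fun _ => 0 := funext h.init
    rw [this]
    exact measurable_const
  | succ k ih =>
    have hw : Measurable[past X (k + 1)] (w k) := ih.mono (past_mono X k.le_succ) le_rfl
    have hx : Measurable[past X (k + 1)] fun ω => x (X k ω) :=
      h.measurable_feature.comp (measurable_past X k.lt_succ_self)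
    rw [show w (k + 1) = _ from funext (h.step k)]
    exact hw.sub ((((hw.inner hx).smul hx).sub_const _).const_smul _)

theorem boundedMeasurable_iterate (h : IsRun Pr D x M wStar K X w) {k : ℕ} (hk : k ≤ K) :
    BoundedMeasurable (w k) := by
  induction k with
  | zero =>
    have : w 0 = fun _ => 0 := funext h.init
    rw [this]
    exact .const 0
  | succ k ih =>
    have hw := ih (by lia)
    have hx := h.boundedMeasurable_feature.comp (h.measurable_sample k hk)
    rw [show w (k + 1) = _ from funext (h.step k)]
    exact hw.sub ((BoundedMeasurable.const _).smul (((hw.inner hx).smul hx).sub (.const _)))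

variable [IsProbabilityMeasure D]

theorem norm_meanIterate_le (h : IsRun Pr D x M wStar K X w) (k : ℕ) :
    ‖meanIterate D x M wStar k‖ ≤ ‖wStar‖ :=
  norm_sub_pow_apply_le (inner_contraction_comm h.boundedMeasurable_feature)
    (norm_contraction_sq_le h.boundedMeasurable_feature h.bound_pos h.norm_feature_sq_le) k wStar

variable [IsProbabilityMeasure Pr]

theorem integral_inner_centred (h : IsRun Pr D x M wStar K X w) {k : ℕ} (hk : k ≤ K) (v : E) :
    ∫ ω, inner ℝ v (w k ω - meanIterate D x M wStar k) ∂Pr = 0 := by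
  induction k generalizing v with
  | zero => simp [h.init, meanIterate_zero]
  | succ k ih =>
    set y := meanIterate D x M wStar k with hy
    set η := 1 / (4 * M) with hη
    have hx := h.boundedMeasurable_feature
    have hxm := h.measurable_feature
    have hw := h.boundedMeasurable_iterate (Nat.le_of_succ_le hk)
    simp only [h.inner_centred_succ, ← hy, ← hη]
    have hvx := (BoundedMeasurable.const (α := Z) v).inner hx
    have hv' : BoundedMeasurable fun z => v - (η * inner ℝ v (x z)) • x z :=
      (BoundedMeasurable.const v).sub (((BoundedMeasurable.const η).mul hvx).smul hx)
    have hq : BoundedMeasurable fun z =>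
        η * (inner ℝ y (x z) * inner ℝ v (x z) - inner ℝ v (secondMoment D x y)) :=
      (BoundedMeasurable.const η).mul
        ((((BoundedMeasurable.const y).inner hx).mul hvx).sub (.const _))
    rw [h.integral_eq_integral_prod hk (h.measurable_past_iterate k)
      (f := fun p : E × Z => inner ℝ (v - (η * inner ℝ v (x p.2)) • x p.2) (p.1 - y)
        - η * (inner ℝ y (x p.2) * inner ℝ v (x p.2) - inner ℝ v (secondMoment D x y)))
      (Measurable.stronglyMeasurable (by fun_prop))]
    have hn : BoundedMeasurable fun ω => w k ω - y := hw.sub (.const y)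
    rw [integral_prod_symm]
    · calc _ = ∫ z, -(η * (inner ℝ y (x z) * inner ℝ v (x z)
            - inner ℝ v (secondMoment D x y))) ∂D := by
            refine integral_congr_ae (.of_forall fun z => ?_)
            dsimp only
            rw [integral_sub (((BoundedMeasurable.const _).inner hn).integrable Pr)
              (integrable_const _), ih (Nat.le_of_succ_le hk), integral_const]
            simp
        _ = 0 := by
            rw [integral_neg, integral_const_mul,
              integral_sub ((((BoundedMeasurable.const y).inner hx).mul hvx).integrable D)
              (integrable_const _), ← inner_secondMoment hx, real_inner_comm]
            simp
    · exact ((((hv'.comp measurable_snd).inner (hn.comp measurable_fst))).sub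
        (hq.comp measurable_snd)).integrable _

/-- The covariance of the iterates stays below a fixed multiple of the identity. The bound
`c = ‖wStar‖² / 7` is the fixed point of the recursion `c (2 η - η² M) = η² M ‖wStar‖²`. -/
theorem integral_inner_centred_sq_le (h : IsRun Pr D x M wStar K X w) {k : ℕ} (hk : k ≤ K)
    (v : E) :
    ∫ ω, inner ℝ v (w k ω - meanIterate D x M wStar k) ^ 2 ∂Pr
      ≤ ‖wStar‖ ^ 2 / 7 * ‖v‖ ^ 2 := by
  induction k generalizing v with
  | zero =>
    simp only [h.init, meanIterate_zero, sub_zero, inner_zero_right]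
    simp only [ne_eq, OfNat.ofNat_ne_zero, not_false_eq_true, zero_pow, integral_zero]
    positivity
  | succ k ih =>
    set y := meanIterate D x M wStar k with hy
    have hM := h.bound_pos
    obtain ⟨η, hη, hηM⟩ : ∃ η : ℝ, 1 / (4 * M) = η ∧ η * M = 1 / 4 :=
      ⟨_, rfl, by field_simp⟩
    have hx := h.boundedMeasurable_feature
    have hxm := h.measurable_feature
    have hw := h.boundedMeasurable_iterate (Nat.le_of_succ_le hk)
    simp only [h.inner_centred_succ, ← hy, hη]
    have hvx := (BoundedMeasurable.const (α := Z) v).inner hx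
    have hyx := (BoundedMeasurable.const (α := Z) y).inner hx
    have hv' : BoundedMeasurable fun z => v - (η * inner ℝ v (x z)) • x z :=
      (BoundedMeasurable.const v).sub (((BoundedMeasurable.const η).mul hvx).smul hx)
    set a := inner ℝ v (secondMoment D x y) with ha
    have hq : BoundedMeasurable fun z => inner ℝ y (x z) * inner ℝ v (x z) - a :=
      (hyx.mul hvx).sub (.const _)
    rw [h.integral_eq_integral_prod hk (h.measurable_past_iterate k)
      (f := fun p : E × Z => (inner ℝ (v - (η * inner ℝ v (x p.2)) • x p.2) (p.1 - y)
        - η * (inner ℝ y (x p.2) * inner ℝ v (x p.2) - a)) ^ 2)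
      (Measurable.stronglyMeasurable (by fun_prop))]
    have hn : BoundedMeasurable fun ω => w k ω - y := hw.sub (.const y)
    have hint : Integrable (fun q : Ω × Z =>
        (inner ℝ (v - (η * inner ℝ v (x q.2)) • x q.2) (w k q.1 - y)
          - η * (inner ℝ y (x q.2) * inner ℝ v (x q.2) - a)) ^ 2) (Pr.prod D) :=
      (((hv'.comp measurable_snd).inner (hn.comp measurable_fst)).sub
        (((BoundedMeasurable.const η).mul hq).comp measurable_snd)).sq.integrable _
    rw [integral_prod_symm _ hint]
    set c := ‖wStar‖ ^ 2 / 7 with hc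
    have hc0 : 0 ≤ c := by positivity
    -- For a frozen sample, the cross term vanishes because the iterate is centred.
    have inner_bound : ∀ z, ∫ ω, (inner ℝ (v - (η * inner ℝ v (x z)) • x z) (w k ω - y)
          - η * (inner ℝ y (x z) * inner ℝ v (x z) - a)) ^ 2 ∂Pr
        ≤ c * ‖v‖ ^ 2 - c * (7 / 4 * η) * inner ℝ v (x z) ^ 2
          + η ^ 2 * (inner ℝ y (x z) * inner ℝ v (x z) - a) ^ 2 := by
      intro z
      set v' := v - (η * inner ℝ v (x z)) • x z with hv'z
      set q := inner ℝ y (x z) * inner ℝ v (x z) - a with hqz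
      have hvn := (BoundedMeasurable.const (α := Ω) v').inner hn
      have e : ∫ ω, (inner ℝ v' (w k ω - y) - η * q) ^ 2 ∂Pr
          = ∫ ω, inner ℝ v' (w k ω - y) ^ 2 ∂Pr + η ^ 2 * q ^ 2 := by
        calc _ = ∫ ω, (inner ℝ v' (w k ω - y) ^ 2
              - (2 * η * q) * inner ℝ v' (w k ω - y) + η ^ 2 * q ^ 2) ∂Pr := by
              congr 1; ext ω; ring
          _ = _ := by
              rw [integral_add, integral_sub, integral_const_mul,
                h.integral_inner_centred (Nat.le_of_succ_le hk), integral_const]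
              · simp
              · exact hvn.sq.integrable _
              · exact ((BoundedMeasurable.const _).mul hvn).integrable _
              · exact (hvn.sq.sub ((BoundedMeasurable.const _).mul hvn)).integrable _
              · exact integrable_const _
      have nv : ‖v'‖ ^ 2 ≤ ‖v‖ ^ 2 - 7 / 4 * η * inner ℝ v (x z) ^ 2 := by
        rw [hv'z, norm_sub_sq_real, inner_smul_right, norm_smul, mul_pow, Real.norm_eq_abs, sq_abs]
        have h1 := h.norm_feature_sq_le z
        have h2 : (η * inner ℝ v (x z)) ^ 2 * ‖x z‖ ^ 2 ≤ (η * inner ℝ v (x z)) ^ 2 * M := by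
          gcongr
        have h3 : (η * inner ℝ v (x z)) ^ 2 * M = (η * M) * (η * inner ℝ v (x z) ^ 2) := by ring
        rw [hηM] at h3
        linarith
      rw [e]
      have := ih (Nat.le_of_succ_le hk) v'
      have := mul_le_mul_of_nonneg_left nv hc0
      linarith
    have hvv := inner_secondMoment_self (D := D) hx v
    have noise : ∫ z, (inner ℝ y (x z) * inner ℝ v (x z) - a) ^ 2 ∂D
        ≤ M * ‖wStar‖ ^ 2 * inner ℝ v (secondMoment D x v) := by
      have e : ∫ z, inner ℝ y (x z) * inner ℝ v (x z) ∂D = a := by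
        rw [← inner_secondMoment hx, real_inner_comm]
      calc _ ≤ ∫ z, (inner ℝ y (x z) * inner ℝ v (x z)) ^ 2 ∂D :=
              e ▸ (hyx.mul hvx).integral_sub_integral_sq_le D
        _ ≤ ∫ z, M * ‖wStar‖ ^ 2 * inner ℝ v (x z) ^ 2 ∂D := by
              refine integral_mono ((hyx.mul hvx).sq.integrable _)
                (((BoundedMeasurable.const _).mul hvx.sq).integrable _) fun z => ?_
              dsimp only
              rw [mul_pow]
              gcongr
              refine (sq_inner_le (h.norm_feature_sq_le z)).trans ?_
              gcongr
              exact h.norm_meanIterate_le k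
        _ = _ := by rw [integral_const_mul, hvv]
    calc _ ≤ ∫ z, (c * ‖v‖ ^ 2 - c * (7 / 4 * η) * inner ℝ v (x z) ^ 2
          + η ^ 2 * (inner ℝ y (x z) * inner ℝ v (x z) - a) ^ 2) ∂D := by
          refine integral_mono hint.integral_prod_right ?_ inner_bound
          exact (((BoundedMeasurable.const _).sub ((BoundedMeasurable.const _).mul hvx.sq)).add
            ((BoundedMeasurable.const _).mul hq.sq)).integrable D
      _ = c * ‖v‖ ^ 2 - c * (7 / 4 * η) * inner ℝ v (secondMoment D x v)
          + η ^ 2 * ∫ z, (inner ℝ y (x z) * inner ℝ v (x z) - a) ^ 2 ∂D := by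
          rw [integral_add, integral_sub, integral_const_mul, integral_const_mul, integral_const,
            integral_const_mul, hvv]
          · simp
          · exact integrable_const _
          · exact ((BoundedMeasurable.const _).mul hvx.sq).integrable _
          · exact ((BoundedMeasurable.const _).sub
              ((BoundedMeasurable.const _).mul hvx.sq)).integrable _
          · exact ((BoundedMeasurable.const _).mul hq.sq).integrable _
      _ ≤ c * ‖v‖ ^ 2 - c * (7 / 4 * η) * inner ℝ v (secondMoment D x v)
          + η ^ 2 * (M * ‖wStar‖ ^ 2 * inner ℝ v (secondMoment D x v)) := by gcongr
      _ = c * ‖v‖ ^ 2 := by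
          have : η ^ 2 * (M * ‖wStar‖ ^ 2 * inner ℝ v (secondMoment D x v))
            = (η * M) * (η * ‖wStar‖ ^ 2 * inner ℝ v (secondMoment D x v)) := by ring
          rw [this, hηM, hc]
          ring

end IsRun

end Run

/-! ### The averaged iterate -/

section Run

variable {Ω Z E : Type*} [MeasurableSpace Z] [NormedAddCommGroup E] [InnerProductSpace ℝ E]
  [mΩ : MeasurableSpace Ω] [MeasurableSpace E] {Pr : Measure Ω} {D : Measure Z} {x : Z → E} {M : ℝ}
  {wStar : E} {K : ℕ} {X : ℕ → Ω → Z} {w : ℕ → Ω → E}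

/-- The component along `p` of the gradient noise of the `k`-th step. -/
noncomputable def noise (D : Measure Z) (x : Z → E) (X : ℕ → Ω → Z) (w : ℕ → Ω → E) (p : E)
    (k : ℕ) (ω : Ω) : ℝ :=
  inner ℝ (w k ω) (x (X k ω)) * inner ℝ p (x (X k ω)) - inner ℝ (secondMoment D x (w k ω)) p

namespace IsRun

variable [FiniteDimensional ℝ E] [BorelSpace E]

theorem measurable_past_noise (h : IsRun Pr D x M wStar K X w) (k : ℕ) (p : E) :
    Measurable[past X (k + 1)] (noise D x X w p k) := by
  have hw := (h.measurable_past_iterate k).mono (past_mono X k.le_succ) le_rfl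
  have hx : Measurable[past X (k + 1)] fun ω => x (X k ω) :=
    h.measurable_feature.comp (measurable_past X k.lt_succ_self)
  exact ((hw.inner hx).mul (hx.const_inner)).sub
    (((secondMoment D x).continuous.measurable.comp hw).inner_const)

theorem boundedMeasurable_average_sub (h : IsRun Pr D x M wStar K X w) :
    BoundedMeasurable fun ω => ((K : ℝ) + 1)⁻¹ • ∑ k ∈ Finset.range (K + 1), w k ω - wStar :=
  ((BoundedMeasurable.const _).smul (.sum _ fun _ hk =>
    h.boundedMeasurable_iterate (Nat.lt_succ_iff.1 (Finset.mem_range.1 hk)))).sub (.const _)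

variable [IsProbabilityMeasure D]

theorem boundedMeasurable_noise (h : IsRun Pr D x M wStar K X w) {k : ℕ} (hk : k < K) (p : E) :
    BoundedMeasurable (noise D x X w p k) := by
  have hx := h.boundedMeasurable_feature.comp (h.measurable_sample k hk)
  have hw := h.boundedMeasurable_iterate hk.le
  have e : noise D x X w p k = fun ω => inner ℝ (w k ω) (x (X k ω)) * inner ℝ p (x (X k ω))
      - inner ℝ (w k ω) (secondMoment D x p) := by
    ext ω
    rw [noise, inner_secondMoment_comm h.boundedMeasurable_feature]
  rw [e]
  exact ((hw.inner hx).mul ((BoundedMeasurable.const p).inner hx)).sub (hw.inner (.const _))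

theorem boundedMeasurable_sum_noise (h : IsRun Pr D x M wStar K X w) {k : ℕ} (hk : k ≤ K)
    (p : E) : BoundedMeasurable fun ω => ∑ j ∈ Finset.range k, noise D x X w p j ω :=
  .sum _ fun _ hj => h.boundedMeasurable_noise ((Finset.mem_range.1 hj).trans_le hk) p

/-- Summing the recursion of the iterates: along `v = H p` the sum of the centred iterates
telescopes, up to the noise along `p`. -/
theorem sum_inner_centred (h : IsRun Pr D x M wStar K X w) (p : E) (k : ℕ) (ω : Ω) :
    ∑ j ∈ Finset.range k, inner ℝ (secondMoment D x p) (w j ω - meanIterate D x M wStar j)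
      = -(4 * M * inner ℝ p (w k ω - meanIterate D x M wStar k))
        - ∑ j ∈ Finset.range k, noise D x X w p j ω := by
  have hM := h.bound_pos
  induction k with
  | zero => simp [h.init, meanIterate_zero]
  | succ k ih =>
    rw [Finset.sum_range_succ, Finset.sum_range_succ, ih, h.inner_centred_succ, noise,
      inner_secondMoment_comm h.boundedMeasurable_feature, inner_secondMoment_comm
      h.boundedMeasurable_feature]
    set y := meanIterate D x M wStar k
    have e1 : inner ℝ p (secondMoment D x (w k ω - y)) = inner ℝ (w k ω) (secondMoment D x p)
        - inner ℝ p (secondMoment D x y) := by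
      rw [map_sub, inner_sub_right, ← inner_secondMoment_comm h.boundedMeasurable_feature,
        real_inner_comm]
    have e2 : inner ℝ (x (X k ω)) (w k ω - y)
        = inner ℝ (w k ω) (x (X k ω)) - inner ℝ y (x (X k ω)) := by
      rw [real_inner_comm, inner_sub_left]
    rw [e1, inner_sub_left, real_inner_smul_left, e2]
    field_simp
    ring

/-- The bias of the averaged iterate. -/
theorem norm_sum_meanIterate_sub_le (h : IsRun Pr D x M wStar K X w) {μ : ℝ} (hμ : 0 < μ)
    (hcoer : ∀ v, μ * ‖v‖ ^ 2 ≤ inner ℝ v (secondMoment D x v)) (hK : 1 ≤ K) :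
    ‖((K : ℝ) + 1)⁻¹ • ∑ k ∈ Finset.range (K + 1), (meanIterate D x M wStar k - wStar)‖ ^ 2
      ≤ 4 * (M / (K * μ)) * ‖wStar‖ ^ 2 := by
  have hM := h.bound_pos
  have hK' : (1 : ℝ) ≤ K := by exact_mod_cast hK
  set A := contraction D x M with hA
  set H := secondMoment D x with hH
  set G := ∑ k ∈ Finset.range (K + 1), (A ^ k) wStar with hG
  have hA' : ∀ v, ‖A v‖ ^ 2 ≤ inner ℝ v (A v) :=
    norm_contraction_sq_le h.boundedMeasurable_feature hM h.norm_feature_sq_le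
  have e : ∑ k ∈ Finset.range (K + 1), (meanIterate D x M wStar k - wStar) = -G := by
    rw [hG, ← Finset.sum_neg_distrib]
    exact Finset.sum_congr rfl fun k _ => by simp [meanIterate, hA]
  have g1 : ‖G‖ ≤ ((K : ℝ) + 1) * ‖wStar‖ := by
    calc ‖G‖ ≤ ∑ k ∈ Finset.range (K + 1), ‖wStar‖ :=
          norm_sum_le_of_le _ fun k _ => norm_pow_apply_le hA' k wStar
      _ = _ := by simp
  -- The geometric sum of `A = 1 - η H` telescopes under `H`.
  have tel : ∀ n : ℕ, H (∑ k ∈ Finset.range n, (A ^ k) wStar)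
      = (4 * M) • (wStar - (A ^ n) wStar) := by
    intro n
    induction n with
    | zero => simp
    | succ n ih =>
      rw [Finset.sum_range_succ, map_add, ih, pow_succ', mul_apply_eq_comp, hA,
        contraction_apply, ← hA, ← hH, smul_sub, smul_sub, smul_sub, smul_smul]
      rw [show 4 * M * (1 / (4 * M)) = 1 by field_simp]
      module
  have g2 : μ * ‖G‖ ≤ 4 * M * ‖wStar‖ := by
    have h1 := hcoer G
    have h2 := real_inner_le_norm G (H G)
    have h3 : ‖H G‖ ≤ 4 * M * ‖wStar‖ := by
      rw [hG, tel, norm_smul, Real.norm_of_nonneg (by positivity)]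
      gcongr
      exact h.norm_meanIterate_le (K + 1)
    rcases (norm_nonneg G).eq_or_lt with h0 | h0
    · rw [← h0, mul_zero]; positivity
    · refine le_trans ?_ h3
      nlinarith
  rw [e, norm_smul, norm_neg, mul_pow, norm_inv, Real.norm_of_nonneg (by positivity), inv_pow,
    inv_mul_le_iff₀ (by positivity)]
  -- The product of the two bounds, which is the geometric mean of `1` and `(4 M / (K μ)) ^ 2`.
  have g3 : μ * ‖G‖ ^ 2 ≤ ((K : ℝ) + 1) * (4 * M) * ‖wStar‖ ^ 2 := by
    calc μ * ‖G‖ ^ 2 = (μ * ‖G‖) * ‖G‖ := by ring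
      _ ≤ (4 * M * ‖wStar‖) * (((K : ℝ) + 1) * ‖wStar‖) := by gcongr
      _ = _ := by ring
  refine le_of_mul_le_mul_left (g3.trans ?_) hμ
  have : μ * (((K : ℝ) + 1) ^ 2 * (4 * (M / (K * μ)) * ‖wStar‖ ^ 2))
      = ((K : ℝ) + 1) * (4 * M) * ‖wStar‖ ^ 2 * ((K + 1) / K) := by field_simp
  rw [this]
  refine le_mul_of_one_le_right (by positivity) ?_
  rw [one_le_div (by positivity)]
  linarith

variable [IsProbabilityMeasure Pr]

theorem integral_inner_iterate_sq_le (h : IsRun Pr D x M wStar K X w) {k : ℕ} (hk : k ≤ K)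
    (v : E) : ∫ ω, inner ℝ v (w k ω) ^ 2 ∂Pr ≤ 8 / 7 * ‖wStar‖ ^ 2 * ‖v‖ ^ 2 := by
  set y := meanIterate D x M wStar k with hy
  have hvn := (BoundedMeasurable.const (α := Ω) v).inner
    ((h.boundedMeasurable_iterate hk).sub (.const y))
  have h1 := h.integral_inner_centred_sq_le hk v
  have h2 : inner ℝ v y ^ 2 ≤ ‖wStar‖ ^ 2 * ‖v‖ ^ 2 := by
    refine sq_inner_le ?_
    have := h.norm_meanIterate_le k
    gcongr
  calc _ = ∫ ω, (inner ℝ v (w k ω - y) ^ 2 + 2 * inner ℝ v y * inner ℝ v (w k ω - y)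
        + inner ℝ v y ^ 2) ∂Pr := by
        congr 1; ext ω; rw [inner_sub_right]; ring
    _ = ∫ ω, inner ℝ v (w k ω - y) ^ 2 ∂Pr + inner ℝ v y ^ 2 := by
        rw [integral_add, integral_add, integral_const_mul, h.integral_inner_centred hk,
          integral_const]
        · simp
        · exact hvn.sq.integrable _
        · exact ((BoundedMeasurable.const _).mul hvn).integrable _
        · exact (hvn.sq.add ((BoundedMeasurable.const _).mul hvn)).integrable _
        · exact integrable_const _
    _ ≤ _ := by linarith

/-- Freezing the iterate bounds the variance of the noise by a second moment; freezing the sample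
then leaves the second moment of the iterate along the feature. -/
theorem integral_noise_sq_le (h : IsRun Pr D x M wStar K X w) {k : ℕ} (hk : k < K) (p : E) :
    ∫ ω, noise D x X w p k ω ^ 2 ∂Pr
      ≤ 8 / 7 * M * ‖wStar‖ ^ 2 * inner ℝ p (secondMoment D x p) := by
  have hx := h.boundedMeasurable_feature
  have hxm := h.measurable_feature
  have hw := h.boundedMeasurable_iterate hk.le
  have hp := (BoundedMeasurable.const (α := Z) p).inner hx
  have hwx : BoundedMeasurable fun q : Ω × Z => inner ℝ (w k q.1) (x q.2) * inner ℝ p (x q.2) :=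
    ((hw.comp measurable_fst).inner (hx.comp measurable_snd)).mul (hp.comp measurable_snd)
  have hH : BoundedMeasurable fun ω => inner ℝ (secondMoment D x (w k ω)) p := by
    simp only [inner_secondMoment_comm hx]
    exact hw.inner (.const _)
  calc _ = ∫ q, (inner ℝ (w k q.1) (x q.2) * inner ℝ p (x q.2)
        - inner ℝ (secondMoment D x (w k q.1)) p) ^ 2 ∂(Pr.prod D) :=
        h.integral_eq_integral_prod hk (h.measurable_past_iterate k)
          (f := fun q : E × Z => (inner ℝ q.1 (x q.2) * inner ℝ p (x q.2)
            - inner ℝ (secondMoment D x q.1) p) ^ 2)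
          (Measurable.stronglyMeasurable (by fun_prop))
    _ = ∫ ω, ∫ z, (inner ℝ (w k ω) (x z) * inner ℝ p (x z)
        - inner ℝ (secondMoment D x (w k ω)) p) ^ 2 ∂D ∂Pr :=
        integral_prod _ ((hwx.sub (hH.comp measurable_fst)).sq.integrable _)
    _ ≤ ∫ ω, ∫ z, (inner ℝ (w k ω) (x z) * inner ℝ p (x z)) ^ 2 ∂D ∂Pr := by
        refine integral_mono
          ((hwx.sub (hH.comp measurable_fst)).sq.integrable (Pr.prod D)).integral_prod_left
          (hwx.sq.integrable (Pr.prod D)).integral_prod_left fun ω => ?_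
        dsimp only
        rw [inner_secondMoment hx]
        exact (hwx.comp (measurable_prodMk_left (x := ω))).integral_sub_integral_sq_le D
    _ = ∫ z, ∫ ω, (inner ℝ (w k ω) (x z) * inner ℝ p (x z)) ^ 2 ∂Pr ∂D :=
        integral_integral_swap (hwx.sq.integrable _)
    _ ≤ ∫ z, 8 / 7 * M * ‖wStar‖ ^ 2 * inner ℝ p (x z) ^ 2 ∂D := by
        refine integral_mono (hwx.sq.integrable (Pr.prod D)).integral_prod_right
          (((BoundedMeasurable.const _).mul hp.sq).integrable D) fun z => ?_
        simp only [mul_pow, integral_mul_const]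
        have h1 := h.integral_inner_iterate_sq_le hk.le (x z)
        have h2 := h.norm_feature_sq_le z
        gcongr
        calc _ ≤ _ := by simpa only [real_inner_comm] using h1
          _ ≤ 8 / 7 * ‖wStar‖ ^ 2 * M := by gcongr
          _ = _ := by ring
    _ = _ := by rw [integral_const_mul, inner_secondMoment_self hx]

/-- The noise is a martingale difference sequence. -/
theorem integral_mul_noise (h : IsRun Pr D x M wStar K X w) {k : ℕ} (hk : k < K) (p : E)
    {T : Ω → ℝ} (hT : BoundedMeasurable T) (hTm : Measurable[past X k] T) :
    ∫ ω, T ω * noise D x X w p k ω ∂Pr = 0 := by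
  have hx := h.boundedMeasurable_feature
  have hxm := h.measurable_feature
  have hw := h.boundedMeasurable_iterate hk.le
  have hp := (BoundedMeasurable.const (α := Z) p).inner hx
  have hH : BoundedMeasurable fun ω => inner ℝ (secondMoment D x (w k ω)) p := by
    simp only [inner_secondMoment_comm hx]
    exact hw.inner (.const _)
  have hint : BoundedMeasurable fun q : Ω × Z => T q.1 * (inner ℝ (w k q.1) (x q.2)
      * inner ℝ p (x q.2) - inner ℝ (secondMoment D x (w k q.1)) p) :=
    (hT.comp measurable_fst).mul ((((hw.comp measurable_fst).inner (hx.comp measurable_snd)).mul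
      (hp.comp measurable_snd)).sub (hH.comp measurable_fst))
  calc _ = ∫ q, T q.1 * (inner ℝ (w k q.1) (x q.2) * inner ℝ p (x q.2)
        - inner ℝ (secondMoment D x (w k q.1)) p) ∂(Pr.prod D) :=
        h.integral_eq_integral_prod hk (hTm.prodMk (h.measurable_past_iterate k))
          (f := fun q : (ℝ × E) × Z => q.1.1 * (inner ℝ q.1.2 (x q.2) * inner ℝ p (x q.2)
            - inner ℝ (secondMoment D x q.1.2) p))
          (Measurable.stronglyMeasurable (by fun_prop))
    _ = ∫ ω, ∫ z, T ω * (inner ℝ (w k ω) (x z) * inner ℝ p (x z)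
        - inner ℝ (secondMoment D x (w k ω)) p) ∂D ∂Pr := integral_prod _ (hint.integrable _)
    _ = ∫ _, 0 ∂Pr := by
        refine integral_congr_ae (.of_forall fun ω => ?_)
        dsimp only
        rw [integral_const_mul, integral_sub, integral_const, inner_secondMoment hx]
        · simp
        · exact (((BoundedMeasurable.const _).inner hx).mul hp).integrable _
        · exact integrable_const _
    _ = 0 := integral_zero _ _

theorem integral_sum_noise_sq_le (h : IsRun Pr D x M wStar K X w) {k : ℕ} (hk : k ≤ K) (p : E) :
    ∫ ω, (∑ j ∈ Finset.range k, noise D x X w p j ω) ^ 2 ∂Pr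
      ≤ k * (8 / 7 * M * ‖wStar‖ ^ 2 * inner ℝ p (secondMoment D x p)) := by
  induction k with
  | zero => simp
  | succ k ih =>
    have hT := h.boundedMeasurable_sum_noise (Nat.le_of_succ_le hk) p
    have hTm : Measurable[past X k] fun ω => ∑ j ∈ Finset.range k, noise D x X w p j ω :=
      Finset.measurable_fun_sum _ fun j hj =>
        (h.measurable_past_noise j p).mono (past_mono X (Finset.mem_range.1 hj)) le_rfl
    have hn := h.boundedMeasurable_noise hk p
    set T := fun ω => ∑ j ∈ Finset.range k, noise D x X w p j ω with hTdef
    calc _ = ∫ ω, (T ω ^ 2 + 2 * (T ω * noise D x X w p k ω) + noise D x X w p k ω ^ 2) ∂Pr := by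
          congr 1; ext ω; rw [Finset.sum_range_succ, hTdef]; ring
      _ = ∫ ω, T ω ^ 2 ∂Pr + ∫ ω, noise D x X w p k ω ^ 2 ∂Pr := by
          rw [integral_add, integral_add, integral_const_mul, h.integral_mul_noise hk p hT hTm]
          · simp
          · exact hT.sq.integrable _
          · exact ((BoundedMeasurable.const _).mul (hT.mul hn)).integrable _
          · exact (hT.sq.add ((BoundedMeasurable.const _).mul (hT.mul hn))).integrable _
          · exact hn.sq.integrable _
      _ ≤ _ := by
          have h1 := ih (Nat.le_of_succ_le hk)
          have h2 := h.integral_noise_sq_le hk p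
          push_cast
          linarith

/-- The variance of the averaged iterate along `v`. The summed recursion gives a bound of order
`1 / (K μ)`; it is needed only when `K μ` is not small against `M`, the covariance bound of the
single iterates being good enough otherwise. -/
theorem integral_inner_average_centred_sq_le (h : IsRun Pr D x M wStar K X w) {μ : ℝ} (hμ : 0 < μ)
    (hcoer : ∀ v, μ * ‖v‖ ^ 2 ≤ inner ℝ v (secondMoment D x v)) (hK : 1 ≤ K) {v p : E}
    (hp : secondMoment D x p = v) :
    ∫ ω, inner ℝ v (((K : ℝ) + 1)⁻¹ • ∑ k ∈ Finset.range (K + 1),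
        (w k ω - meanIterate D x M wStar k)) ^ 2 ∂Pr
      ≤ 8 * (M / (K * μ)) * ‖wStar‖ ^ 2 * ‖v‖ ^ 2 := by
  have hM := h.bound_pos
  have hx := h.boundedMeasurable_feature
  have hK' : (1 : ℝ) ≤ K := by exact_mod_cast hK
  have hn : ∀ k ≤ K, BoundedMeasurable fun ω => inner ℝ v (w k ω - meanIterate D x M wStar k) :=
    fun k hk => (BoundedMeasurable.const v).inner
      ((h.boundedMeasurable_iterate hk).sub (.const _))
  set S : Ω → ℝ := fun ω =>
    ∑ k ∈ Finset.range (K + 1), inner ℝ v (w k ω - meanIterate D x M wStar k) with hS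
  have hSb : BoundedMeasurable S := .sum _ fun k hk => hn k (by simpa [Nat.lt_succ_iff] using hk)
  have e : ∀ ω, inner ℝ v (((K : ℝ) + 1)⁻¹ • ∑ k ∈ Finset.range (K + 1),
      (w k ω - meanIterate D x M wStar k)) ^ 2 = (((K : ℝ) + 1) ^ 2)⁻¹ * S ω ^ 2 := by
    intro ω
    rw [real_inner_smul_right, inner_sum, mul_pow, inv_pow]
  simp only [e, integral_const_mul]
  set r := M / (K * μ) with hr
  have hr0 : 0 < r := by positivity
  set b := ‖wStar‖ ^ 2 * ‖v‖ ^ 2 with hb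
  have hb0 : 0 ≤ b := by positivity
  suffices hmain : ∫ ω, S ω ^ 2 ∂Pr ≤ ((K : ℝ) + 1) ^ 2 * (8 * r * b) by
    rw [inv_mul_le_iff₀ (by positivity)]
    linarith
  -- The telescoped bound `32 / 7 * r ^ 2 + 16 / 7 * r` is at most `8 * r` exactly for `r ≤ 5 / 4`.
  rcases le_total (5 / 4) r with hr' | hr'
  · calc _ ≤ ∫ ω, ((K : ℝ) + 1) * ∑ k ∈ Finset.range (K + 1),
            inner ℝ v (w k ω - meanIterate D x M wStar k) ^ 2 ∂Pr := by
          refine integral_mono (hSb.sq.integrable _) (((BoundedMeasurable.const _).mul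
            (.sum _ fun k hk => (hn k (by simpa [Nat.lt_succ_iff] using hk)).sq)).integrable _)
            fun ω => ?_
          simpa using sq_sum_le_card_mul_sum_sq (s := Finset.range (K + 1))
            (f := fun k => inner ℝ v (w k ω - meanIterate D x M wStar k))
      _ = ((K : ℝ) + 1) * ∑ k ∈ Finset.range (K + 1),
            ∫ ω, inner ℝ v (w k ω - meanIterate D x M wStar k) ^ 2 ∂Pr := by
          rw [integral_const_mul, integral_finsetSum]
          exact fun k hk => (hn k (by simpa [Nat.lt_succ_iff] using hk)).sq.integrable _
      _ ≤ ((K : ℝ) + 1) * ∑ k ∈ Finset.range (K + 1), b / 7 := by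
          gcongr with k hk
          have := h.integral_inner_centred_sq_le (by simpa [Nat.lt_succ_iff] using hk) v
          rw [hb]
          linarith
      _ = ((K : ℝ) + 1) ^ 2 * (b / 7) := by
          rw [Finset.sum_const, Finset.card_range, nsmul_eq_mul]
          push_cast
          ring
      _ ≤ _ := by
          gcongr
          nlinarith
  · set c := inner ℝ p v with hc
    have hpc : inner ℝ p (secondMoment D x p) = c := by rw [hp]
    have hv2 : ‖v‖ ^ 2 ≤ M * c := by
      simpa only [hp] using norm_secondMoment_sq_le (D := D) hx hM h.norm_feature_sq_le p
    have hcp : μ * ‖p‖ ^ 2 ≤ c := hpc ▸ hcoer p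
    have hcle : c ≤ ‖p‖ * ‖v‖ := real_inner_le_norm p v
    have hpv : μ * ‖p‖ ≤ ‖v‖ := by
      rcases (norm_nonneg p).eq_or_lt with h0 | h0
      · rw [← h0]; simp
      · nlinarith
    have hcv : μ * c ≤ ‖v‖ ^ 2 := by nlinarith [norm_nonneg v]
    have hc0 : 0 ≤ c := le_trans (by positivity) hcp
    -- The last iterate enters once more, as it is averaged but not followed by a step.
    have hd : ‖v - (4 * M) • p‖ ^ 2 ≤ 16 * (M / μ) ^ 2 * ‖v‖ ^ 2 := by
      rw [norm_sub_sq_real, real_inner_smul_right, norm_smul, mul_pow, Real.norm_eq_abs, sq_abs,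
        real_inner_comm, ← hc]
      have h1 : (M / μ) ^ 2 * (μ * ‖p‖) ^ 2 ≤ (M / μ) ^ 2 * ‖v‖ ^ 2 := by gcongr
      have h2 : (M / μ) ^ 2 * (μ * ‖p‖) ^ 2 = M ^ 2 * ‖p‖ ^ 2 := by field_simp
      have h3 : 0 ≤ M * c := by positivity
      linarith
    have hS' : ∀ ω, S ω = inner ℝ (v - (4 * M) • p) (w K ω - meanIterate D x M wStar K)
        - ∑ j ∈ Finset.range K, noise D x X w p j ω := by
      intro ω
      rw [hS]
      dsimp only
      rw [Finset.sum_range_succ, ← hp, h.sum_inner_centred, inner_sub_left, real_inner_smul_left]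
      ring
    have hl := (BoundedMeasurable.const (α := Ω) (v - (4 * M) • p)).inner
      ((h.boundedMeasurable_iterate le_rfl).sub (.const (meanIterate D x M wStar K)))
    have hN := h.boundedMeasurable_sum_noise le_rfl p
    calc _ ≤ ∫ ω, (2 * inner ℝ (v - (4 * M) • p) (w K ω - meanIterate D x M wStar K) ^ 2
            + 2 * (∑ j ∈ Finset.range K, noise D x X w p j ω) ^ 2) ∂Pr := by
          refine integral_mono (hSb.sq.integrable _) ((((BoundedMeasurable.const _).mul hl.sq).add
            ((BoundedMeasurable.const _).mul hN.sq)).integrable _) fun ω => ?_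
          dsimp only
          rw [hS']
          nlinarith [sq_nonneg (inner ℝ (v - (4 * M) • p) (w K ω - meanIterate D x M wStar K)
            + ∑ j ∈ Finset.range K, noise D x X w p j ω)]
      _ = 2 * ∫ ω, inner ℝ (v - (4 * M) • p) (w K ω - meanIterate D x M wStar K) ^ 2 ∂Pr
            + 2 * ∫ ω, (∑ j ∈ Finset.range K, noise D x X w p j ω) ^ 2 ∂Pr := by
          rw [integral_add, integral_const_mul, integral_const_mul]
          · exact ((BoundedMeasurable.const _).mul hl.sq).integrable _
          · exact ((BoundedMeasurable.const _).mul hN.sq).integrable _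
      _ ≤ 2 * (‖wStar‖ ^ 2 / 7 * (16 * (M / μ) ^ 2 * ‖v‖ ^ 2))
            + 2 * (K * (8 / 7 * M * ‖wStar‖ ^ 2 * (‖v‖ ^ 2 / μ))) := by
          gcongr
          · exact (h.integral_inner_centred_sq_le le_rfl _).trans (by gcongr)
          · refine (h.integral_sum_noise_sq_le le_rfl p).trans ?_
            rw [hpc]
            gcongr
            rw [le_div_iff₀ hμ]
            linarith
      _ = (K : ℝ) ^ 2 * ((32 / 7 * r ^ 2 + 16 / 7 * r) * b) := by
          rw [hr, hb]
          field_simp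
          ring
      _ ≤ ((K : ℝ) + 1) ^ 2 * (8 * r * b) := by
          gcongr
          · linarith
          · nlinarith

/-- Mean squared error of the averaged iterate: squared bias plus the variances along an
orthonormal basis. -/
theorem integral_norm_average_sub_sq_le (h : IsRun Pr D x M wStar K X w) {μ : ℝ} (hμ : 0 < μ)
    (hcoer : ∀ v, μ * ‖v‖ ^ 2 ≤ inner ℝ v (secondMoment D x v))
    (hsurj : Function.Surjective (secondMoment D x)) (hK : 1 ≤ K) :
    ∫ ω, ‖((K : ℝ) + 1)⁻¹ • ∑ k ∈ Finset.range (K + 1), w k ω - wStar‖ ^ 2 ∂Pr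
      ≤ 4 * (M / (K * μ)) * (2 * Module.finrank ℝ E + 1) * ‖wStar‖ ^ 2 := by
  set N : Ω → E := fun ω => ((K : ℝ) + 1)⁻¹ • ∑ k ∈ Finset.range (K + 1),
    (w k ω - meanIterate D x M wStar k) with hN
  set B := ((K : ℝ) + 1)⁻¹ • ∑ k ∈ Finset.range (K + 1), (meanIterate D x M wStar k - wStar)
    with hB
  have hNb : BoundedMeasurable N :=
    (BoundedMeasurable.const _).smul (.sum _ fun k hk =>
      (h.boundedMeasurable_iterate (Nat.lt_succ_iff.1 (Finset.mem_range.1 hk))).sub (.const _))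
  have hdec : ∀ ω, ((K : ℝ) + 1)⁻¹ • ∑ k ∈ Finset.range (K + 1), w k ω - wStar = N ω + B := by
    intro ω
    rw [hN, hB]
    dsimp only
    rw [← smul_add, ← Finset.sum_add_distrib]
    simp only [sub_add_sub_cancel, Finset.sum_sub_distrib, smul_sub, Finset.sum_const,
      Finset.card_range]
    rw [← Nat.cast_smul_eq_nsmul ℝ, smul_smul, Nat.cast_add_one, inv_mul_cancel₀ (by positivity),
      one_smul]
  -- The centred average `N` and the bias `B` are orthogonal in the mean.
  have hcross : ∫ ω, inner ℝ (N ω) B ∂Pr = 0 := by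
    have : ∀ ω, inner ℝ (N ω) B = ((K : ℝ) + 1)⁻¹ * ∑ k ∈ Finset.range (K + 1),
        inner ℝ B (w k ω - meanIterate D x M wStar k) := by
      intro ω
      rw [hN, real_inner_comm, real_inner_smul_right, inner_sum]
    simp only [this, integral_const_mul]
    rw [integral_finsetSum]
    · rw [Finset.sum_eq_zero, mul_zero]
      exact fun k hk =>
        h.integral_inner_centred (Nat.lt_succ_iff.1 (Finset.mem_range.1 hk)) B
    · exact fun k hk => ((BoundedMeasurable.const B).inner ((h.boundedMeasurable_iterate
        (Nat.lt_succ_iff.1 (Finset.mem_range.1 hk))).sub (.const _))).integrable _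
  have hvar : ∫ ω, ‖N ω‖ ^ 2 ∂Pr
      ≤ Module.finrank ℝ E * (8 * (M / (K * μ)) * ‖wStar‖ ^ 2) := by
    let o := stdOrthonormalBasis ℝ E
    have e : ∀ ω, ‖N ω‖ ^ 2 = ∑ i, inner ℝ (o i) (N ω) ^ 2 := by
      intro ω
      rw [← o.sum_sq_norm_inner_right (N ω)]
      simp
    simp only [e]
    rw [integral_finsetSum _ fun i _ =>
      (((BoundedMeasurable.const (o i)).inner hNb).sq.integrable _)]
    calc _ ≤ ∑ _i : Fin (Module.finrank ℝ E), 8 * (M / (K * μ)) * ‖wStar‖ ^ 2 := by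
          refine Finset.sum_le_sum fun i _ => ?_
          obtain ⟨p, hp⟩ := hsurj (o i)
          have := h.integral_inner_average_centred_sq_le hμ hcoer hK hp
          rwa [o.norm_eq_one, one_pow, mul_one] at this
      _ = _ := by simp
  have hbias := h.norm_sum_meanIterate_sub_le hμ hcoer hK
  simp only [hdec, norm_add_sq_real]
  have hNB := hNb.inner (BoundedMeasurable.const B)
  rw [integral_add, integral_add, integral_const_mul, hcross, integral_const]
  · simp only [probReal_univ, smul_eq_mul, one_mul, mul_zero, add_zero]
    rw [← hB] at hbias
    linarith
  · exact hNb.norm_sq.integrable _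
  · exact ((BoundedMeasurable.const _).mul hNB).integrable _
  · exact (hNb.norm_sq.add ((BoundedMeasurable.const _).mul hNB)).integrable _
  · exact integrable_const _

/-- Given the past samples, the stochastic gradient has the gradient at the current iterate as its
mean. -/
theorem condExp_stochGrad (h : IsRun Pr D x M wStar K X w) {k : ℕ} (hk : k < K) (u : E) :
    Pr[fun ω => inner ℝ (w k ω) (x (X k ω)) • x (X k ω) - u | past X k]
      =ᵐ[Pr] fun ω => secondMoment D x (w k ω) - u := by
  have hx := h.boundedMeasurable_feature
  have hxm := h.measurable_feature
  have hw := h.boundedMeasurable_iterate hk.le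
  have hle := h.past_le hk.le
  have hxX := hx.comp (h.measurable_sample k hk)
  have hg : Integrable (fun ω => secondMoment D x (w k ω) - u) Pr :=
    ((secondMoment D x).integrable_comp (hw.integrable Pr)).sub (integrable_const u)
  symm
  refine ae_eq_condExp_of_forall_setIntegral_eq hle
    ((((hw.inner hxX).smul hxX).sub (.const u)).integrable Pr) (fun s _ _ => hg.integrableOn)
    (fun s hs _ => ?_) ?_
  · -- An event of the past enters through its indicator, frozen along with the iterate.
    have hind : Measurable[past X k] (s.indicator fun _ => (1 : ℝ)) := measurable_const.indicator hs
    set T : Ω → ℝ := s.indicator fun _ => (1 : ℝ) with hT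
    have hTb : BoundedMeasurable T := by
      refine ⟨hind.mono hle le_rfl, 1, fun ω => ?_⟩
      by_cases hω : ω ∈ s <;> simp [hT, hω]
    have e : ∀ f : Ω → E, ∫ ω in s, f ω ∂Pr = ∫ ω, T ω • f ω ∂Pr := by
      intro f
      rw [← integral_indicator (hle s hs)]
      congr 1
      ext ω
      by_cases hω : ω ∈ s <;> simp [hT, hω]
    rw [e, e]
    have hxsnd := hx.comp (β := Ω × Z) measurable_snd
    have hwfst := hw.comp (β := Ω × Z) measurable_fst
    symm
    calc _ = ∫ q, T q.1 • (inner ℝ (w k q.1) (x q.2) • x q.2 - u) ∂(Pr.prod D) :=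
          h.integral_eq_integral_prod hk (hind.prodMk (h.measurable_past_iterate k))
            (f := fun q : (ℝ × E) × Z => q.1.1 • (inner ℝ q.1.2 (x q.2) • x q.2 - u))
            (Measurable.stronglyMeasurable (by fun_prop))
      _ = ∫ ω, ∫ z, T ω • (inner ℝ (w k ω) (x z) • x z - u) ∂D ∂Pr :=
          integral_prod _ (((hTb.comp measurable_fst).smul
            (((hwfst.inner hxsnd).smul hxsnd).sub (.const u))).integrable _)
      _ = _ := by
          refine integral_congr_ae (.of_forall fun ω => ?_)
          dsimp only
          rw [integral_smul, integral_sub, integral_const, secondMoment_apply hx]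
          · simp
          · exact (((BoundedMeasurable.const _).inner hx).smul hx).integrable _
          · exact integrable_const _
  · exact (((secondMoment D x).continuous.measurable.comp
      (h.measurable_past_iterate k)).sub_const u).stronglyMeasurable.aestronglyMeasurable

end IsRun

end Run

/-! ### The regression objective -/

section Quadratic

variable {Z E : Type*} [MeasurableSpace Z] [NormedAddCommGroup E] [InnerProductSpace ℝ E]
  {D : Measure Z} {x : Z → E}

theorem norm_le_norm_secondMoment {μ : ℝ}
    (hcoer : ∀ v, μ * ‖v‖ ^ 2 ≤ inner ℝ v (secondMoment D x v)) (v : E) :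
    μ * ‖v‖ ≤ ‖secondMoment D x v‖ := by
  have h1 := hcoer v
  have h2 := real_inner_le_norm v (secondMoment D x v)
  rcases (norm_nonneg v).eq_or_lt with h0 | h0
  · rw [← h0, mul_zero]; positivity
  · nlinarith

variable [FiniteDimensional ℝ E] [MeasurableSpace E] [BorelSpace E] [IsProbabilityMeasure D]

/-- The regression objective as a quadratic form. -/
theorem regression_eq (hx : BoundedMeasurable x) (u w : E) :
    1 / 2 * (∫ z, inner ℝ w (x z) ^ 2 ∂D) - inner ℝ w u
      = 1 / 2 * inner ℝ w (secondMoment D x w) - inner ℝ w u := by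
  rw [inner_secondMoment_self hx]

theorem hasGradientAt_regression (hx : BoundedMeasurable x) (u w : E) :
    HasGradientAt (fun w => 1 / 2 * (∫ z, inner ℝ w (x z) ^ 2 ∂D) - inner ℝ w u)
      (secondMoment D x w - u) w := by
  have := FiniteDimensional.complete ℝ E
  simp only [regression_eq hx]
  rw [hasGradientAt_iff_hasFDerivAt]
  have h1 := ((hasFDerivAt_id (𝕜 := ℝ) w).inner ℝ (secondMoment D x).hasFDerivAt).const_mul (1 / 2)
  have h2 := (hasFDerivAt_id (𝕜 := ℝ) w).inner ℝ (hasFDerivAt_const u w)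
  convert! h1.sub h2 using 1
  ext v
  have h3 : inner ℝ w (secondMoment D x v) = inner ℝ v (secondMoment D x w) := by
    rw [← inner_secondMoment_comm hx, real_inner_comm]
  simp only [map_sub, sub_apply, InnerProductSpace.toDual_apply_apply,
    smul_apply, ContinuousLinearMap.comp_apply,
    ContinuousLinearMap.prod_apply, ContinuousLinearMap.id_apply, fderivInnerCLM_apply, id_eq,
    zero_apply, inner_zero_right, h3, smul_eq_mul, real_inner_comm v]
  ring

theorem regression_lt (hx : BoundedMeasurable x) {μ : ℝ} (hμ : 0 < μ)
    (hcoer : ∀ v, μ * ‖v‖ ^ 2 ≤ inner ℝ v (secondMoment D x v)) {wStar w : E} (hw : w ≠ wStar) :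
    1 / 2 * (∫ z, inner ℝ wStar (x z) ^ 2 ∂D) - inner ℝ wStar (secondMoment D x wStar)
      < 1 / 2 * (∫ z, inner ℝ w (x z) ^ 2 ∂D) - inner ℝ w (secondMoment D x wStar) := by
  rw [regression_eq hx, regression_eq hx]
  have h1 := hcoer (w - wStar)
  have h2 : 0 < ‖w - wStar‖ := norm_pos_iff.2 (sub_ne_zero.2 hw)
  have h3 : 0 < μ * ‖w - wStar‖ ^ 2 := by positivity
  have h4 : inner ℝ wStar (secondMoment D x w) = inner ℝ w (secondMoment D x wStar) := by
    rw [← inner_secondMoment_comm hx, real_inner_comm]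
  simp only [map_sub, inner_sub_left, inner_sub_right, h4] at h1
  linarith

end Quadratic

/-! ### Score and Fisher matrix of a policy -/

section Policy

variable {S A : Type*} [MeasurableSpace S] [MeasurableSpace A] {d : ℕ} {ν : Measure A}
  {π : NPG.ParamPolicy d S ν} {θ : EuclideanSpace ℝ (Fin d)} {Mg μF : ℝ}

/-- Coordinates of the score are limits of difference quotients of the log-density. -/
theorem measurable_score (h : π.ScoreBounded θ Mg) : Measurable (π.score θ) := by
  have hcoord : ∀ i, Measurable fun z => π.score θ z i := by
    intro i
    set e : EuclideanSpace ℝ (Fin d) := EuclideanSpace.single i 1 with he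
    have hm : ∀ θ', Measurable fun z : S × A => Real.log (π.density θ' z.1 z.2) := fun θ' =>
      Real.measurable_log.comp (π.measurable_density θ')
    refine measurable_of_tendsto_metrizable (f := fun (n : ℕ) (z : S × A) => (n : ℝ) •
      (Real.log (π.density (θ + (n : ℝ)⁻¹ • e) z.1 z.2) - Real.log (π.density θ z.1 z.2)))
      (fun n => ((hm _).sub (hm _)).const_smul (n : ℝ)) ?_
    rw [tendsto_pi_nhds]
    rintro ⟨s, a⟩
    have hd := (h s a).2.1.hasGradientAt.hasFDerivAt
    have hl := hd.lim_real e
    have : (InnerProductSpace.toDual ℝ _ (π.score θ (s, a))) e = π.score θ (s, a) i := by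
      rw [InnerProductSpace.toDual_apply_apply, he, EuclideanSpace.inner_single_right]
      simp
    rw [← this]
    exact hl.comp tendsto_natCast_atTop_atTop
  exact (WithLp.measurable_toLp 2 _).comp (measurable_pi_lambda _ hcoord)

theorem boundedMeasurable_score (h : π.ScoreBounded θ Mg) : BoundedMeasurable (π.score θ) :=
  ⟨measurable_score h, √Mg, fun z => Real.le_sqrt_of_sq_le (h z.1 z.2).2.2⟩

variable [SigmaFinite ν] {M : NPG.MDP S A} {ρ : Measure S}

theorem isUnit_fisher (hμ : 0 < μF) (hF : NPG.FisherNondegenerate M ρ π θ μF) :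
    IsUnit (NPG.fisher M ρ π θ) := by
  have h1 : (μF • (1 : Matrix (Fin d) (Fin d) ℝ)).PosDef := Matrix.PosDef.one.smul hμ
  have h2 := Matrix.PosDef.posSemidef_add hF h1
  rw [sub_add_cancel] at h2
  exact h2.isUnit

variable [IsProbabilityMeasure (NPG.visitation M ρ π θ)]

theorem secondMoment_score (h : π.ScoreBounded θ Mg) (v : EuclideanSpace ℝ (Fin d)) :
    secondMoment (NPG.visitation M ρ π θ) (π.score θ) v
      = WithLp.toLp 2 (NPG.fisher M ρ π θ *ᵥ v.ofLp) := by
  have hx := boundedMeasurable_score h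
  have hc : ∀ i, BoundedMeasurable fun z => π.score θ z i := fun i => by
    have := (BoundedMeasurable.const (α := S × A) (EuclideanSpace.single i (1 : ℝ))).inner hx
    simpa [EuclideanSpace.inner_single_left] using this
  ext i
  have e : ∀ w : EuclideanSpace ℝ (Fin d), w i = inner ℝ w (EuclideanSpace.single i (1 : ℝ)) := by
    simp [EuclideanSpace.inner_single_right]
  rw [e, inner_secondMoment hx]
  simp only [Matrix.mulVec, dotProduct, NPG.fisher, Matrix.of_apply]
  simp only [← integral_mul_const]
  rw [← integral_finsetSum]
  · refine integral_congr_ae (.of_forall fun z => ?_)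
    dsimp only
    rw [EuclideanSpace.inner_single_left]
    simp only [PiLp.inner_apply, RCLike.inner_apply, conj_trivial, Finset.sum_mul, map_one, one_mul]
    exact Finset.sum_congr rfl fun j _ => by ring
  · exact fun j _ => (((hc i).mul (hc j)).mul (.const _)).integrable _

theorem coercive_secondMoment_score (h : π.ScoreBounded θ Mg)
    (hF : NPG.FisherNondegenerate M ρ π θ μF) (v : EuclideanSpace ℝ (Fin d)) :
    μF * ‖v‖ ^ 2
      ≤ inner ℝ v (secondMoment (NPG.visitation M ρ π θ) (π.score θ) v) := by
  have h1 := hF.dotProduct_mulVec_nonneg v.ofLp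
  rw [Matrix.sub_mulVec, dotProduct_sub, Matrix.smul_mulVec, Matrix.one_mulVec,
    dotProduct_smul] at h1
  rw [secondMoment_score h, ← real_inner_self_eq_norm_sq, EuclideanSpace.inner_eq_star_dotProduct,
    EuclideanSpace.inner_eq_star_dotProduct]
  simp only [star_trivial, smul_eq_mul] at h1 ⊢
  rw [dotProduct_comm (NPG.fisher M ρ π θ *ᵥ v.ofLp)]
  linarith

theorem secondMoment_exactDirection (h : π.ScoreBounded θ Mg) (hμ : 0 < μF)
    (hF : NPG.FisherNondegenerate M ρ π θ μF) (u : EuclideanSpace ℝ (Fin d)) :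
    secondMoment (NPG.visitation M ρ π θ) (π.score θ) (NPG.exactDirection M ρ π u θ) = u := by
  rw [secondMoment_score h, NPG.exactDirection, Matrix.mulVec_mulVec,
    Matrix.mul_nonsing_inv _ ((Matrix.isUnit_iff_isUnit_det _).1 (isUnit_fisher hμ hF)),
    Matrix.one_mulVec]

end Policy

end AveragedSGD

open AveragedSGD in
theorem mainTheorem5 {S A Ω : Type*} [MeasurableSpace S] [MeasurableSpace A] [MeasurableSpace Ω]
    {d : ℕ} {ν : Measure A} [SigmaFinite ν]
    (M : NPG.MDP S A) (ρ : Measure S) [IsProbabilityMeasure ρ] (π : NPG.ParamPolicy d S ν)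
    (u θ : EuclideanSpace ℝ (Fin d)) (Mg μF : ℝ) (hMg : 0 < Mg) (hμF : 0 < μF)
    (hscore : π.ScoreBounded θ Mg)
    (hfisher : NPG.FisherNondegenerate M ρ π θ μF)
    (K : ℕ) (hK : 1 ≤ K)
    (Pr : Measure Ω) [IsProbabilityMeasure Pr] (X : ℕ → Ω → S × A)
    (hXmeas : ∀ k < K, Measurable (X k))
    (hXlaw : ∀ k < K, Pr.map (X k) = NPG.visitation M ρ π θ)
    (hXindep : iIndepFun (fun k : Fin K => X k) Pr) :
    -- `F(θ)` is invertible and `F(θ)⁻¹ u` is the unique minimizer of the loss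
    (IsUnit (NPG.fisher M ρ π θ) ∧
      ∀ w, w ≠ NPG.exactDirection M ρ π u θ →
        NPG.loss M ρ π θ u (NPG.exactDirection M ρ π u θ) < NPG.loss M ρ π θ u w) ∧
    -- the stochastic gradient is an unbiased estimate of the gradient of the loss,
    -- at every fixed point and, given the past samples, at the current iterate
    (∀ w, Integrable (NPG.stochGrad π θ u w) (NPG.visitation M ρ π θ) ∧
      HasGradientAt (NPG.loss M ρ π θ u)
        (∫ z, NPG.stochGrad π θ u w z ∂(NPG.visitation M ρ π θ)) w) ∧
    (∀ k < K,
      Pr[fun ω => NPG.stochGrad π θ u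
            (NPG.sgdIterate π θ u (1 / (4 * Mg)) (fun j => X j ω) k) (X k ω) |
          ⨆ j : Fin k, MeasurableSpace.comap (X j) inferInstance]
        =ᵐ[Pr] fun ω => gradient (NPG.loss M ρ π θ u)
            (NPG.sgdIterate π θ u (1 / (4 * Mg)) (fun j => X j ω) k)) ∧
    -- the error bound for the averaged iterate
    (Integrable (fun ω =>
        ‖NPG.sgdOutput π θ u (1 / (4 * Mg)) (fun k => X k ω) K
          - NPG.exactDirection M ρ π u θ‖ ^ 2) Pr ∧
      ∫ ω, ‖NPG.sgdOutput π θ u (1 / (4 * Mg)) (fun k => X k ω) K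
          - NPG.exactDirection M ρ π u θ‖ ^ 2 ∂Pr
        ≤ 4 * Mg * (Real.sqrt (2 * d) + 1) ^ 2 / (K * μF ^ 3) * ‖u‖ ^ 2) := by
  -- The visitation measure is a probability measure, being the law of the first sample.
  have hprob : IsProbabilityMeasure (NPG.visitation M ρ π θ) :=
    hXlaw 0 hK ▸ Measure.isProbabilityMeasure_map (hXmeas 0 hK).aemeasurable
  have hx := boundedMeasurable_score hscore
  have hcoer := coercive_secondMoment_score (M := M) (ρ := ρ) hscore hfisher
  have hdir := secondMoment_exactDirection (M := M) (ρ := ρ) hscore hμF hfisher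
  have hrun : IsRun Pr (NPG.visitation M ρ π θ) (π.score θ) Mg (NPG.exactDirection M ρ π u θ) K X
      (fun k ω => NPG.sgdIterate π θ u (1 / (4 * Mg)) (fun j => X j ω) k) :=
    { measurable_feature := hx.1
      bound_pos := hMg
      norm_feature_sq_le := fun z => (hscore z.1 z.2).2.2
      measurable_sample := hXmeas
      map_sample := hXlaw
      indep := fun k hk => indep_past_of_iIndepFun hXmeas hXindep hk
      init := fun _ => rfl
      step := fun k ω => by rw [hdir]; rfl }
  have hgrad : ∀ w, HasGradientAt (NPG.loss M ρ π θ u)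
      (secondMoment (NPG.visitation M ρ π θ) (π.score θ) w - u) w :=
    hasGradientAt_regression hx u
  refine ⟨⟨isUnit_fisher hμF hfisher, fun w hw => ?_⟩, fun w => ?_, fun k hk => ?_, ?_, ?_⟩
  · have := regression_lt hx hμF hcoer hw
    rwa [hdir] at this
  · have hg := ((BoundedMeasurable.const w).inner hx).smul hx
    refine ⟨(hg.sub (.const u)).integrable _, ?_⟩
    convert hgrad w using 1
    simp only [NPG.stochGrad]
    rw [integral_sub (hg.integrable _) (integrable_const u), ← secondMoment_apply hx]
    simp
  · refine (hrun.condExp_stochGrad hk u).trans (.of_forall fun ω => ?_)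
    exact (hgrad _).gradient.symm
  · exact hrun.boundedMeasurable_average_sub.norm_sq.integrable Pr
  · refine (hrun.integral_norm_average_sub_sq_le hμF hcoer (fun v => ⟨_, hdir v⟩) hK).trans ?_
    have hu : μF * ‖NPG.exactDirection M ρ π u θ‖ ≤ ‖u‖ := by
      simpa only [hdir] using norm_le_norm_secondMoment hcoer (NPG.exactDirection M ρ π u θ)
    have hK' : (0 : ℝ) < K := by exact_mod_cast hK
    have hd : 2 * (d : ℝ) + 1 ≤ (√(2 * d) + 1) ^ 2 := by
      nlinarith [Real.sq_sqrt (show (0 : ℝ) ≤ 2 * d by positivity), Real.sqrt_nonneg (2 * (d : ℝ))]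
    rw [finrank_euclideanSpace_fin]
    calc _ = 4 * Mg * (2 * d + 1) / (K * μF ^ 3)
          * (μF * ‖NPG.exactDirection M ρ π u θ‖) ^ 2 := by field_simp
      _ ≤ _ := by gcongr
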